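/- Let $N,k\ge 0$ be integers and let $V=\mathbb{C}[X_i^{(j)} : 0\le i\le N,\ j\ge 0]$ be the algebra of differential polynomials in $N+1$ variables. For an integer $m$, let $V^{(m)}\subset V$ be the subalgebra generated by the $X_i^{(j)}$ with $j\le m$ (so $V^{(-1)}=\mathbb{C}$). For an invertible formal series $\alpha\in\mathbb{C}[[T]]^{\times}$ and $P\in V$, let $\alpha\cdot P$ be the differential polynomial obtained from $P$ by substituting, for all $i$ and $j$, \[ X_i^{(j)}\longmapsto \sum_{l=0}^{j}\binom{j}{l}\,\alpha^{(j-l)}(0)\,X_i^{(l)} . \] For $d\ge 0$, let $V_d^{\mathrm{Diff}}=\{P\in V : \alpha\cdot P=\alpha(0)^dP \text{ for all } \alpha\in\mathbb{C}[[T]]^{\times}\}$ be the space of differentially homogeneous polynomials of degree $d$, let $V^{\mathrm{Diff}}=\sum_{d\ge 0}V_d^{\mathrm{Diff}}$, a subalgebra of $V$, and put $(V_d^{\mathrm{Diff}})^{(m)}=V_d^{\mathrm{Diff}}\cap V^{(m)}$ and $(V^{\mathrm{Diff}})^{(m)}=V^{\mathrm{Diff}}\cap V^{(m)}$. Then the $\mathbb{C}$-algebra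 $(V^{\mathrm{Diff}})^{(k)}$ is finitely generated. More precisely, for every choice, for each $1\le i\le k+1$, of a family $\mathcal{B}_i$ of elements of $(V_i^{\mathrm{Diff}})^{(i-1)}$ that induces a basis of the quotient space $(V_i^{\mathrm{Diff}})^{(i-1)}/(V_i^{\mathrm{Diff}})^{(i-2)}$, one has \[ (V^{\mathrm{Diff}})^{(k)}=\mathbb{C}[\mathcal{B}_1,\mathcal{B}_2,\dots,\mathcal{B}_{k+1}], \] the subalgebra of $V$ generated by all the elements of $\mathcal{B}_1,\dots,\mathcal{B}_{k+1}$. -/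

import Mathlib

noncomputable section

namespace DiffHom

/-- The algebra `V = ℂ[X^(0), X^(1), …]` of differential polynomials in `N + 1` variables:
the pair `(i, j)` stands for the formal variable `X_i^(j)`. -/
abbrev V (N : ℕ) : Type := MvPolynomial (Fin (N + 1) × ℕ) ℂ

/-- `V^(k)`: the differential polynomials of order at most `k`, that is, the polynomials in the
variables `X_i^(j)` with `j ≤ k`. The order is an integer, so that `V^(-1)` makes sense: it
consists of the constants. -/
def orderLE (N : ℕ) (k : ℤ) : Subalgebra ℂ (V N) :=
  MvPolynomial.supported ℂ {p : Fin (N + 1) × ℕ | (p.2 : ℤ) ≤ k}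

/-- `α^(m)(0)`, the value at `T = 0` of the `m`-th formal derivative of `α ∈ ℂ[[T]]`. -/
def derivAtZero (α : PowerSeries ℂ) (m : ℕ) : ℂ :=
  PowerSeries.constantCoeff ((PowerSeries.derivative ℂ)^[m] α)

/-- `(α X_i)^(k)` at `T = 0`, by the Leibniz rule:
`∑_{j ≤ k} (k choose j) α^(k-j)(0) X_i^(j)`. -/
def leibniz (N : ℕ) (α : PowerSeries ℂ) (i : Fin (N + 1)) (k : ℕ) : V N :=
  ∑ j ∈ Finset.range (k + 1),
    ((k.choose j : ℂ) * derivAtZero α (k - j)) • MvPolynomial.X (i, j)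

/-- The transformation `P ↦ α · P = P((αX)^(0), (αX)^(1), …)|_{T = 0}` of `V`. -/
def act (N : ℕ) (α : (PowerSeries ℂ)ˣ) : V N →ₐ[ℂ] V N :=
  MvPolynomial.aeval fun p : Fin (N + 1) × ℕ => leibniz N (α : PowerSeries ℂ) p.1 p.2

/-- `V_d^Diff`: the space of differentially homogeneous polynomials of degree `d`, those `P` with
`α · P = α(0)^d P` for every invertible formal series `α`. -/
def VDiff (N d : ℕ) : Submodule ℂ (V N) where
  carrier := {P | ∀ α : (PowerSeries ℂ)ˣ,
    act N α P = (PowerSeries.constantCoeff (α : PowerSeries ℂ)) ^ d • P}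
  add_mem' := by
    intro P Q hP hQ α
    rw [map_add, hP α, hQ α, smul_add]
  zero_mem' := by
    intro α
    rw [map_zero, smul_zero]
  smul_mem' := by
    intro c P hP α
    rw [map_smul, hP α, smul_comm]

/-- `(V_d^Diff)^(k)`: the differentially homogeneous polynomials of degree `d` and order at
most `k`. -/
def VDiffOrder (N d : ℕ) (k : ℤ) : Submodule ℂ (V N) :=
  VDiff N d ⊓ Subalgebra.toSubmodule (orderLE N k)

theorem one_mem_VDiff (N : ℕ) : (1 : V N) ∈ VDiff N 0 := by
  intro α
  rw [map_one, pow_zero, one_smul]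

theorem mul_mem_VDiff (N : ℕ) {d e : ℕ} {P Q : V N} (hP : P ∈ VDiff N d) (hQ : Q ∈ VDiff N e) :
    P * Q ∈ VDiff N (d + e) := by
  intro α
  rw [map_mul, hP α, hQ α, pow_add, smul_mul_smul_comm]

/-- `V^Diff`, the sum of all the `V_d^Diff`, as a subalgebra of `V`. -/
def diffAlgebra (N : ℕ) : Subalgebra ℂ (V N) :=
  Submodule.toSubalgebra (⨆ d : ℕ, VDiff N d)
    (Submodule.mem_iSup_of_mem 0 (one_mem_VDiff N))
    (by
      intro P Q hP hQ
      induction hP using Submodule.iSup_induction' with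
      | mem d P hP =>
        induction hQ using Submodule.iSup_induction' with
        | mem e Q hQ => exact Submodule.mem_iSup_of_mem (d + e) (mul_mem_VDiff N hP hQ)
        | zero => rw [mul_zero]; exact Submodule.zero_mem _
        | add Q R _ _ hQ hR => rw [mul_add]; exact Submodule.add_mem _ hQ hR
      | zero => rw [zero_mul]; exact Submodule.zero_mem _
      | add P R _ _ hP hR => rw [add_mul]; exact Submodule.add_mem _ hP hR)

/-- `(V^Diff)^(k)`: the subalgebra of `V^Diff` of the elements of order at most `k`. -/
def diffAlgebraOrder (N : ℕ) (k : ℤ) : Subalgebra ℂ (V N) :=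
  diffAlgebra N ⊓ orderLE N k

/-- A family `b` in a subspace `W` induces a basis of the quotient of `W` by (its intersection
with) `W'`: the classes of the `b j` are linearly independent and span. -/
def InducesBasis {E : Type*} [AddCommGroup E] [Module ℂ E] (W W' : Submodule ℂ E)
    {ι : Type*} (b : ι → W) : Prop :=
  LinearIndependent ℂ (fun j => (W'.submoduleOf W).mkQ (b j)) ∧
    Submodule.span ℂ (Set.range fun j => (W'.submoduleOf W).mkQ (b j)) = ⊤

end DiffHom

end

noncomputable section

namespace DiffHom

open scoped Nat

/-! The proof rests on one explicit generating set: the determinants `detPoly` of the first b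
coefficients of b generic series ∑ X_i^(j) T^j / j!, each shifted by a power of T, with b ≤ k + 1.
Multiplying the series by α multiplies the matrix by a triangular Toeplitz matrix, so such a
determinant is differentially homogeneous of degree b. It has order at most b - 1, and it vanishes
if some shift is at least b, so finitely many remain.

That they generate is a statement about linear functionals. An element P of degree d is homogeneous,
hence recovered from its polarizations, one functional F on ℂ[x_1, …, x_d] for each word w of length
d (`factorial_mul_eq_sum_ofPolarization`). Invariance of P under 1 - zT says that the elementary
symmetric polynomials of positive degree annihilate F; order at most k says that every x_i^(k+1)
does. Together these force h_r(T) to annihilate F once r + |T| > min(|T|(k+1), d), which is the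
number of cells in the first |T| columns of a diagram with columns k+1, …, k+1, remainder
(`polarization_mem_harmonics`). These are relations of the kind Tanisaki and Garsia–Procesi use.
Removing one variable and one cell at a time, `harmonics_le_span` shows that the functionals
satisfying them are spanned by those coming from products of Vandermonde determinants of columns.
Such a functional corresponds to a block determinant, that is, a product of `detPoly`s of size at
most k + 1.

For arbitrary families B_i, induct on i: modulo the span of B_i, an element of degree i and order at
most i - 1 has order at most i - 2, hence is a polynomial in determinants of size at most i - 1. -/

/-! ### Complete symmetric polynomials annihilating a functional. -/

/-- The complete homogeneous symmetric polynomial of degree `r` in the variables indexed by `T`. -/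
def hsum {σ : Type*} (T : Finset σ) (r : ℕ) : MvPolynomial σ ℂ :=
  PowerSeries.coeff r
    (∏ i ∈ T, PowerSeries.mk fun a => (MvPolynomial.X i : MvPolynomial σ ℂ) ^ a)

theorem hsum_insert {σ : Type*} [DecidableEq σ] {T : Finset σ} {n : σ} (hn : n ∉ T) (r : ℕ) :
    hsum (insert n T) r =
      ∑ p ∈ Finset.HasAntidiagonal.antidiagonal r, MvPolynomial.X n ^ p.1 * hsum T p.2 := by
  simp only [hsum, Finset.prod_insert hn, PowerSeries.coeff_mul, PowerSeries.coeff_mk]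

theorem hsum_singleton {σ : Type*} (n : σ) (r : ℕ) :
    hsum {n} r = (MvPolynomial.X n : MvPolynomial σ ℂ) ^ r := by
  simp [hsum]

theorem rename_hsum {σ τ : Type*} (f : σ ↪ τ) (T : Finset σ) (r : ℕ) :
    MvPolynomial.rename f (hsum T r) = hsum (T.map f) r := by
  have h := PowerSeries.coeff_map
    (MvPolynomial.rename f : MvPolynomial σ ℂ →ₐ[ℂ] MvPolynomial τ ℂ).toRingHom r
    (∏ i ∈ T, PowerSeries.mk fun a => (MvPolynomial.X i : MvPolynomial σ ℂ) ^ a)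
  rw [map_prod] at h
  rw [hsum, hsum, Finset.prod_map]
  refine h.symm.trans (congrArg _ (Finset.prod_congr rfl fun i _ => ?_))
  ext1 a
  simp

/-- The largest ideal on which the linear functional `F` vanishes. -/
def ann {σ : Type*} (F : MvPolynomial σ ℂ →ₗ[ℂ] ℂ) : Ideal (MvPolynomial σ ℂ) where
  carrier := {g | ∀ f, F (f * g) = 0}
  add_mem' := by
    intro a b ha hb f
    rw [mul_add, map_add, ha, hb, add_zero]
  zero_mem' := by
    intro f
    rw [mul_zero, map_zero]
  smul_mem' := by
    intro c g hg f
    rw [smul_eq_mul, ← mul_assoc]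
    exact hg _

theorem mk_pow_mul_one_sub {R : Type*} [CommRing R] (x : R) :
    (PowerSeries.mk fun a => x ^ a) * (1 - PowerSeries.C x * PowerSeries.X) = 1 := by
  ext n
  rw [mul_sub, mul_one, ← mul_assoc, map_sub]
  cases n with
  | zero => simp
  | succ n =>
    rw [PowerSeries.coeff_succ_mul_X, mul_comm, PowerSeries.coeff_C_mul]
    simp [PowerSeries.coeff_one, pow_succ']

/-- The coefficients of positive degree of a polynomial `∏ (1 - z xᵢ)` that acts trivially on a
functional annihilate this functional. -/
theorem coeff_prod_mem_ann {σ : Type*} {F : MvPolynomial σ ℂ →ₗ[ℂ] ℂ} {U : Finset σ}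
    (hF : ∀ (z : ℂ) (g : MvPolynomial σ ℂ),
      F (g * ∏ i ∈ U, (1 - MvPolynomial.C z * MvPolynomial.X i)) = F g)
    {s : ℕ} (hs : s ≠ 0) :
    (∏ i ∈ U, (1 - Polynomial.C (MvPolynomial.X i : MvPolynomial σ ℂ) * Polynomial.X)).coeff s
      ∈ ann F := by
  intro g
  set Q := ∏ i ∈ U, (1 - Polynomial.C (MvPolynomial.X i : MvPolynomial σ ℂ) * Polynomial.X)
    with hQ
  -- Both sides are polynomials in z with the same value at every complex z, so their coefficients
  -- can be compared.
  have key : ∑ s ∈ Finset.range (Q.natDegree + 1), Polynomial.monomial s (F (g * Q.coeff s)) =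
      Polynomial.C (F g) := by
    refine Polynomial.funext fun z => ?_
    rw [Polynomial.eval_finsetSum, Polynomial.eval_C, ← hF z g]
    have : ∏ i ∈ U, (1 - MvPolynomial.C z * MvPolynomial.X i : MvPolynomial σ ℂ) =
        Q.eval (MvPolynomial.C z) := by
      rw [hQ, Polynomial.eval_prod]
      refine Finset.prod_congr rfl fun i _ => ?_
      rw [Polynomial.eval_sub, Polynomial.eval_one, Polynomial.eval_mul, Polynomial.eval_C,
        Polynomial.eval_X, mul_comm]
    rw [this, Polynomial.eval_eq_sum_range, Finset.mul_sum, map_sum]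
    refine Finset.sum_congr rfl fun s _ => ?_
    rw [Polynomial.eval_monomial, ← map_pow, ← mul_assoc, mul_comm _ (MvPolynomial.C _),
      ← MvPolynomial.smul_eq_C_mul, map_smul, smul_eq_mul, mul_comm]
  by_cases h : s ∈ Finset.range (Q.natDegree + 1)
  · have := congrArg (fun p => Polynomial.coeff p s) key
    simp only [Polynomial.finsetSum_coeff, Polynomial.coeff_monomial, Finset.sum_ite_eq', h,
      if_true, Polynomial.coeff_C, hs, if_false] at this
    exact this
  · rw [Polynomial.coeff_eq_zero_of_natDegree_lt, mul_zero, map_zero]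
    simpa using h

/-- Multiplying the generating series of the h_r(T) by Q = ∏_U (1 - x_i t) leaves ∏_(U \ T) (1 - x_i
t), of degree at most |U| - |T|. Modulo `ann F` the polynomial Q is 1, so h_r(T) vanishes beyond
that degree. -/
theorem hsum_mem_ann_of_invariant {σ : Type*} {F : MvPolynomial σ ℂ →ₗ[ℂ] ℂ} {T U : Finset σ}
    (hTU : T ⊆ U)
    (hF : ∀ (z : ℂ) (g : MvPolynomial σ ℂ),
      F (g * ∏ i ∈ U, (1 - MvPolynomial.C z * MvPolynomial.X i)) = F g)
    {r : ℕ} (hr : U.card < r + T.card) : hsum T r ∈ ann F := by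
  classical
  set Q := ∏ i ∈ U, (1 - Polynomial.C (MvPolynomial.X i : MvPolynomial σ ℂ) * Polynomial.X)
    with hQ
  set E := ∏ i ∈ U \ T, (1 - Polynomial.C (MvPolynomial.X i : MvPolynomial σ ℂ) * Polynomial.X)
    with hE
  have hEr : E.coeff r = 0 := by
    apply Polynomial.coeff_eq_zero_of_natDegree_lt
    have h1 : E.natDegree ≤ (U \ T).card := by
      refine (Polynomial.natDegree_prod_le _ _).trans ?_
      rw [Finset.card_eq_sum_ones]
      refine Finset.sum_le_sum fun i _ => ?_
      compute_degree
    have h2 := Finset.card_sdiff_add_card_eq_card hTU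
    omega
  have hmul : (∏ i ∈ T, PowerSeries.mk fun a => (MvPolynomial.X i : MvPolynomial σ ℂ) ^ a) *
      (Q : PowerSeries (MvPolynomial σ ℂ)) = E := by
    have hcoe : ∀ S : Finset σ, ((∏ i ∈ S, (1 - Polynomial.C (MvPolynomial.X i : MvPolynomial σ ℂ) *
        Polynomial.X) : Polynomial (MvPolynomial σ ℂ)) : PowerSeries (MvPolynomial σ ℂ)) =
        ∏ i ∈ S, (1 - PowerSeries.C (MvPolynomial.X i) * PowerSeries.X) := by
      intro S
      rw [← Polynomial.coeToPowerSeries.ringHom_apply, map_prod]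
      refine Finset.prod_congr rfl fun i _ => ?_
      simp
    rw [hQ, hE, hcoe, hcoe, ← Finset.prod_sdiff hTU, mul_left_comm, ← Finset.prod_mul_distrib]
    simp only [mk_pow_mul_one_sub, Finset.prod_const_one, mul_one]
  have hc := congrArg (PowerSeries.coeff r) hmul
  have hQ0 : Q.coeff 0 = 1 := by
    rw [Polynomial.coeff_zero_eq_eval_zero, hQ, Polynomial.eval_prod]
    simp
  rw [PowerSeries.coeff_mul, Polynomial.coeff_coe, hEr,
    ← Finset.add_sum_erase _ _ (Finset.HasAntidiagonal.mem_antidiagonal.mpr (add_zero r) : (r, 0) ∈ _),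
    Polynomial.coeff_coe, hQ0, mul_one] at hc
  rw [hsum, eq_neg_of_add_eq_zero_left hc]
  refine neg_mem (sum_mem fun p hp => Ideal.mul_mem_left _ _ ?_)
  rw [Polynomial.coeff_coe]
  refine coeff_prod_mem_ann hF fun h => ?_
  rw [Finset.mem_erase, Finset.HasAntidiagonal.mem_antidiagonal, h, add_zero] at hp
  exact hp.1 (Prod.ext hp.2 h)

/-- A monomial of degree above |T| k has an exponent of at least k + 1. -/
theorem hsum_mem_of_pow_mem {σ : Type*} {I : Ideal (MvPolynomial σ ℂ)} {k : ℕ}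
    (hI : ∀ i, MvPolynomial.X i ^ (k + 1) ∈ I) {T : Finset σ} {r : ℕ} (hr : T.card * k < r) :
    hsum T r ∈ I := by
  classical
  rw [hsum, PowerSeries.coeff_prod]
  refine sum_mem fun l hl => ?_
  rw [Finset.mem_finsuppAntidiag] at hl
  obtain ⟨i, hi, hk⟩ : ∃ i ∈ T, k < l i := by
    by_contra! h
    have := Finset.sum_le_card_nsmul T l k h
    rw [smul_eq_mul] at this
    omega
  refine Ideal.mem_of_dvd I (Finset.dvd_prod_of_mem _ hi) ?_
  rw [PowerSeries.coeff_mk]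
  exact Ideal.mem_of_dvd I (pow_dvd_pow _ hk) (hI i)

/-! ### Fillings of diagrams and block determinants. -/

/-- The pairs `(π i, lev i)` run bijectively through the cells `(c, κ)`, `κ < β c`, of the diagram
with column lengths `β`. -/
structure IsFilling {ι : Type*} (β : ℕ → ℕ) (π lev : ι → ℕ) : Prop where
  inj : ∀ i j, π i = π j → lev i = lev j → i = j
  lt : ∀ i, lev i < β (π i)
  surj : ∀ c κ, κ < β c → ∃ i, π i = c ∧ lev i = κ

section BlockMatrix

variable {ι R : Type*} [CommRing R] {π lev : ι → ℕ}

/-- The matrix whose `i`-th row lists the coefficients of the series `f i` in the columns of the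
block of `i`. -/
def blockMatrix (π lev : ι → ℕ) (f : ι → PowerSeries R) : Matrix ι ι R :=
  Matrix.of fun i j => if π i = π j then PowerSeries.coeff (lev j) (f i) else 0

theorem blockMatrix_apply (π lev : ι → ℕ) (f : ι → PowerSeries R) (i j : ι) :
    blockMatrix π lev f i j = if π i = π j then PowerSeries.coeff (lev j) (f i) else 0 := rfl

theorem map_blockMatrix {S : Type*} [CommRing S] (ψ : R →+* S) (π lev : ι → ℕ)
    (f : ι → PowerSeries R) :
    (blockMatrix π lev f).map ψ = blockMatrix π lev fun i => PowerSeries.map ψ (f i) := by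
  ext i j
  simp [blockMatrix_apply, apply_ite ψ]

variable [Fintype ι] [DecidableEq ι]

/-- Multiplication of the row series by α is right multiplication by a Toeplitz matrix on each
block. Truncation is harmless because a filled block contains every level below any of its levels.
-/
theorem det_blockMatrix_mul {β : ℕ → ℕ} (h : IsFilling β π lev) (α : ℕ → PowerSeries R)
    (f : ι → PowerSeries R) :
    (blockMatrix π lev fun i => f i * α (π i)).det =
      (blockMatrix π lev f).det * ∏ i, PowerSeries.constantCoeff (α (π i)) := by
  let A : Matrix ι ι R := Matrix.of fun j j' =>
    if π j = π j' ∧ lev j ≤ lev j' then PowerSeries.coeff (lev j' - lev j) (α (π j)) else 0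
  have hA : A.det = ∏ i, PowerSeries.constantCoeff (α (π i)) := by
    have hinj : Function.Injective fun i => toLex (lev i, π i) := by
      intro i j hij
      have := congrArg ofLex hij
      simp only [ofLex_toLex, Prod.mk.injEq] at this
      exact h.inj i j this.2 this.1
    -- Ordering by level makes `A` upper triangular; the block index only breaks ties between
    -- different blocks, where the entry is zero.
    let O : LinearOrder ι := LinearOrder.lift' (fun i => toLex (lev i, π i)) hinj
    have htri : A.BlockTriangular id := by
      intro i j hij
      have hlt : toLex (lev j, π j) < toLex (lev i, π i) := hij
      rw [Prod.Lex.toLex_lt_toLex] at hlt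
      refine if_neg ?_
      rintro ⟨h1, h2⟩
      omega
    have := Matrix.det_of_isUpperTriangular htri
    convert this using 2 with i
    · simp [A]
  rw [← hA, ← Matrix.det_mul]
  congr 1
  ext i j'
  rw [Matrix.mul_apply, blockMatrix_apply]
  split_ifs with hij
  · rw [PowerSeries.coeff_mul, Finset.Nat.sum_antidiagonal_eq_sum_range_succ_mk,
      ← Finset.sum_filter_of_ne (s := Finset.univ)
        (p := fun j => π i = π j ∧ lev j ≤ lev j')]
    · symm
      refine Finset.sum_nbij lev ?_ ?_ ?_ ?_
      · intro j hj
        simp only [Finset.mem_filter, Finset.mem_range] at hj ⊢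
        omega
      · intro j hj l hl hjl
        simp only [Finset.coe_filter, Set.mem_ofPred_eq] at hj hl
        exact h.inj j l (by omega) hjl
      · intro κ hκ
        simp only [Finset.coe_range, Set.mem_Iio] at hκ
        obtain ⟨j, hj, hjκ⟩ := h.surj (π j') κ (by have := h.lt j'; omega)
        refine ⟨j, ?_, hjκ⟩
        simp only [Finset.coe_filter, Set.mem_ofPred_eq, Finset.mem_univ, true_and]
        omega
      · intro j hj
        simp only [Finset.mem_filter, Finset.mem_univ, true_and] at hj
        rw [blockMatrix_apply, if_pos hj.1]
        simp only [A, Matrix.of_apply]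
        rw [if_pos ⟨hj.1.symm.trans hij, hj.2⟩, hj.1]
    · intro j _ hj
      rw [blockMatrix_apply] at hj
      by_contra hc
      apply hj
      by_cases h1 : π i = π j
      · have hA0 : A j j' = 0 := if_neg (by omega)
        rw [hA0, mul_zero]
      · rw [if_neg h1, zero_mul]
  · symm
    refine Finset.sum_eq_zero fun j _ => ?_
    rw [blockMatrix_apply]
    by_cases h1 : π i = π j
    · have hA0 : A j j' = 0 := if_neg (by omega)
      rw [hA0, mul_zero]
    · rw [if_neg h1, zero_mul]

theorem det_blockMatrix_sum (π lev : ι → ℕ) {E : Type*} (s : Finset E) (y : ι → E → R)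
    (g : ι → E → PowerSeries R) :
    (blockMatrix π lev fun i => ∑ e ∈ s, PowerSeries.C (y i e) * g i e).det =
      ∑ e ∈ Fintype.piFinset fun _ : ι => s,
        (∏ i, y i (e i)) * (blockMatrix π lev fun i => g i (e i)).det := by
  have h := (Matrix.detRowAlternating (n := ι) (R := R)).toMultilinearMap.map_sum_finset
    (fun i e => y i e • fun j => if π i = π j then PowerSeries.coeff (lev j) (g i e) else 0)
    (fun _ : ι => s)
  have hl : (blockMatrix π lev fun i => ∑ e ∈ s, PowerSeries.C (y i e) * g i e) =
      fun i => ∑ e ∈ s,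
        y i e • fun j => if π i = π j then PowerSeries.coeff (lev j) (g i e) else 0 := by
    ext i j
    rw [blockMatrix_apply, Finset.sum_apply]
    split_ifs with hij <;> simp [hij, PowerSeries.coeff_C_mul]
  rw [hl]
  refine h.trans (Finset.sum_congr rfl fun e _ => ?_)
  rw [MultilinearMap.map_smul_univ, smul_eq_mul]
  rfl

end BlockMatrix

/-! ### Functionals of fillings and their vanishing conditions. -/

theorem monomial_one_eq_prod {ι : Type*} [Fintype ι] (m : ι →₀ ℕ) :
    MvPolynomial.monomial m (1 : ℂ) = ∏ i, MvPolynomial.X i ^ m i := by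
  rw [MvPolynomial.monomial_eq, map_one, one_mul, Finsupp.prod_fintype]
  intro i
  rw [pow_zero]

theorem linearMap_ext_prod {ι M : Type*} [Fintype ι] [AddCommGroup M] [Module ℂ M]
    {F G : MvPolynomial ι ℂ →ₗ[ℂ] M}
    (h : ∀ e : ι → ℕ, F (∏ i, MvPolynomial.X i ^ e i) = G (∏ i, MvPolynomial.X i ^ e i)) :
    F = G := by
  refine (MvPolynomial.basisMonomials ι ℂ).ext fun e => ?_
  rw [MvPolynomial.coe_basisMonomials]
  have := h e
  rwa [← monomial_one_eq_prod] at this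

section TabFunctional

variable {ι : Type*} [Fintype ι] [DecidableEq ι] {β : ℕ → ℕ} {π lev : ι → ℕ}

/-- The functional on polynomials dual to the partial derivative with exponent `a` of the product
of the Vandermonde determinants of the blocks. -/
def tabFunctional (π lev a : ι → ℕ) : MvPolynomial ι ℂ →ₗ[ℂ] ℂ :=
  (MvPolynomial.basisMonomials ι ℂ).constr ℂ fun e =>
    (blockMatrix π lev fun i => (PowerSeries.X : PowerSeries ℂ) ^ (a i + e i)).det

theorem tabFunctional_prod (π lev a e : ι → ℕ) :
    tabFunctional π lev a (∏ i, MvPolynomial.X i ^ e i) =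
      (blockMatrix π lev fun i => (PowerSeries.X : PowerSeries ℂ) ^ (a i + e i)).det := by
  have h := monomial_one_eq_prod (Finsupp.equivFunOnFinite.symm e)
  simp only [Finsupp.equivFunOnFinite_symm_apply_apply] at h
  have hb := (MvPolynomial.basisMonomials ι ℂ).constr_basis ℂ (fun e : ι →₀ ℕ =>
    (blockMatrix π lev fun i => (PowerSeries.X : PowerSeries ℂ) ^ (a i + e i)).det)
    (Finsupp.equivFunOnFinite.symm e)
  rw [MvPolynomial.coe_basisMonomials] at hb
  rw [← h]
  exact hb

/-- The factor multiplies the row series of the blocks in S by 1 - zT, whose constant coefficient is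
1, so no determinant changes. -/
theorem tabFunctional_mul_prod (h : IsFilling β π lev) (a : ι → ℕ) (S : Finset ℕ) (z : ℂ)
    (g : MvPolynomial ι ℂ) :
    tabFunctional π lev a
      (g * ∏ i with π i ∈ S, (1 - MvPolynomial.C z * MvPolynomial.X i)) =
      tabFunctional π lev a g := by
  suffices hs : tabFunctional π lev a ∘ₗ LinearMap.mulRight ℂ
      (∏ i with π i ∈ S, (1 - MvPolynomial.C z * MvPolynomial.X i)) = tabFunctional π lev a from
    LinearMap.congr_fun hs g
  refine linearMap_ext_prod fun e => ?_
  rw [LinearMap.comp_apply, LinearMap.mulRight_apply]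
  let y : ι → ℕ → ℂ := fun i κ => if κ = 0 then 1 else if π i ∈ S then -z else 0
  let α : ℕ → PowerSeries ℂ := fun c => if c ∈ S then 1 - PowerSeries.C z * PowerSeries.X else 1
  have h1 : (∏ i with π i ∈ S, (1 - MvPolynomial.C z * MvPolynomial.X i) : MvPolynomial ι ℂ) =
      ∏ i, ∑ κ ∈ Finset.range 2, MvPolynomial.C (y i κ) * MvPolynomial.X i ^ κ := by
    rw [Finset.prod_filter]
    refine Finset.prod_congr rfl fun i _ => ?_
    rw [Finset.sum_range_succ, Finset.sum_range_one]
    split_ifs with hi <;> simp [y, hi, sub_eq_add_neg]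
  have h2 : ∀ κ : ι → ℕ, (∏ i, MvPolynomial.X i ^ e i : MvPolynomial ι ℂ) *
      ∏ i, (MvPolynomial.C (y i (κ i)) * MvPolynomial.X i ^ κ i) =
      (∏ i, y i (κ i)) • ∏ i, MvPolynomial.X i ^ (e i + κ i) := by
    intro κ
    rw [Finset.prod_mul_distrib, MvPolynomial.smul_eq_C_mul, map_prod]
    simp only [pow_add, Finset.prod_mul_distrib]
    ring
  rw [h1, Finset.prod_univ_sum, Finset.mul_sum, map_sum]
  simp only [h2, map_smul, smul_eq_mul, tabFunctional_prod]
  have h3 := det_blockMatrix_sum π lev (Finset.range 2) y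
    fun i κ => (PowerSeries.X : PowerSeries ℂ) ^ (a i + (e i + κ))
  rw [← h3]
  have h4 := det_blockMatrix_mul h α fun i => (PowerSeries.X : PowerSeries ℂ) ^ (a i + e i)
  have h5 : ∏ i, PowerSeries.constantCoeff (α (π i)) = 1 := by
    refine Finset.prod_eq_one fun i _ => ?_
    simp only [α]
    split_ifs <;> simp
  rw [h5, mul_one] at h4
  rw [← h4]
  congr 2
  funext i
  rw [Finset.sum_range_succ, Finset.sum_range_one]
  by_cases hi : π i ∈ S
  · simp only [y, α, if_pos hi, if_true, one_ne_zero, if_false, map_one, map_neg]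
    ring
  · simp [y, α, hi]

end TabFunctional

/-- The functionals annihilated by the complete symmetric polynomials `h_r(T)` of too large degree
with respect to the column lengths `β`. -/
def harmonics (ι : Type*) (β : ℕ → ℕ) : Submodule ℂ (MvPolynomial ι ℂ →ₗ[ℂ] ℂ) where
  carrier := {F | ∀ T : Finset ι, T.Nonempty → ∀ r,
    ∑ c ∈ Finset.range T.card, β c < r + T.card → hsum T r ∈ ann F}
  add_mem' := by
    intro F G hF hG T hT r hr f
    rw [LinearMap.add_apply, hF T hT r hr f, hG T hT r hr f, add_zero]
  zero_mem' := by
    intro T _ r _ f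
    rw [LinearMap.zero_apply]
  smul_mem' := by
    intro a F hF T hT r hr f
    rw [LinearMap.smul_apply, hF T hT r hr f, smul_zero]

/-- The functionals attached to the fillings of the diagram with column lengths `β`. -/
def tabFunctionals (ι : Type*) [Fintype ι] [DecidableEq ι] (β : ℕ → ℕ) :
    Set (MvPolynomial ι ℂ →ₗ[ℂ] ℂ) :=
  {F | ∃ π lev a : ι → ℕ, IsFilling β π lev ∧ F = tabFunctional π lev a}

theorem sum_le_sum_range_card_of_antitone {β : ℕ → ℕ} (hβ : Antitone β) (S : Finset ℕ) :
    ∑ c ∈ S, β c ≤ ∑ c ∈ Finset.range S.card, β c := by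
  induction S using Finset.induction_on_max with
  | empty => simp
  | insert a S ha ih =>
    have hn : a ∉ S := fun h => lt_irrefl _ (ha a h)
    have hc : S.card ≤ a := by
      have : S ⊆ Finset.range a := fun x hx => Finset.mem_range.mpr (ha x hx)
      simpa using Finset.card_le_card this
    rw [Finset.sum_insert hn, Finset.card_insert_of_notMem hn, Finset.sum_range_succ, add_comm]
    exact add_le_add ih (hβ hc)

/-- Take U to be all cells of the columns meeting T: these are at most |T| columns, so they hold no
more cells than the first |T| columns. -/
theorem tabFunctional_mem_harmonics {ι : Type*} [Fintype ι] [DecidableEq ι] {β : ℕ → ℕ}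
    (hβ : Antitone β) {π lev : ι → ℕ} (h : IsFilling β π lev) (a : ι → ℕ) :
    tabFunctional π lev a ∈ harmonics ι β := by
  intro T _ r hr
  let S := T.image π
  refine hsum_mem_ann_of_invariant (U := {i | π i ∈ S}) ?_
    (fun z g => tabFunctional_mul_prod h a S z g) (lt_of_le_of_lt ?_ hr)
  · intro i hi
    simpa only [Finset.mem_filter, Finset.mem_univ, true_and] using Finset.mem_image_of_mem π hi
  · rw [Finset.card_eq_sum_card_fiberwise (f := π) (t := S)]
    · calc _ ≤ ∑ c ∈ S, β c := by
            refine Finset.sum_le_sum fun c _ => ?_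
            rw [← Finset.card_range (β c)]
            refine Finset.card_le_card_of_injOn lev ?_ ?_
            · intro i hi
              simp only [Finset.coe_filter, Set.mem_ofPred_eq] at hi
              simpa [← hi.2] using h.lt i
            · intro i hi j hj hij
              simp only [Finset.coe_filter, Set.mem_ofPred_eq] at hi hj
              exact h.inj i j (hi.2.trans hj.2.symm) hij
        _ ≤ ∑ c ∈ Finset.range S.card, β c := sum_le_sum_range_card_of_antitone hβ S
        _ ≤ _ := Finset.sum_le_sum_of_subset (Finset.range_subset_range.mpr Finset.card_image_le)
    · intro i hi
      simpa using hi

theorem span_tabFunctionals_le_harmonics {ι : Type*} [Fintype ι] [DecidableEq ι] {β : ℕ → ℕ}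
    (hβ : Antitone β) : Submodule.span ℂ (tabFunctionals ι β) ≤ harmonics ι β := by
  rw [Submodule.span_le]
  rintro _ ⟨π, lev, a, h, rfl⟩
  exact tabFunctional_mem_harmonics hβ h a

/-! ### Spanning by fillings: removing one variable and one cell. -/

section Lift

variable {n c : ℕ} {β : ℕ → ℕ} {π lev : Fin n → ℕ}

theorem IsFilling.snoc (h : IsFilling (Function.update β c (β c - 1)) π lev) (hc : 0 < β c) :
    IsFilling β (Fin.snoc π c : Fin (n + 1) → ℕ) (Fin.snoc lev (β c - 1) : Fin (n + 1) → ℕ) where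
  inj := by
    have hlt : ∀ i, π i = c → lev i < β c - 1 := fun i hi => by
      simpa [hi] using h.lt i
    intro i j
    induction i using Fin.lastCases with
    | last =>
      induction j using Fin.lastCases with
      | last => simp
      | cast j =>
        simp only [Fin.snoc_last, Fin.snoc_castSucc]
        intro h1 h2
        have := hlt j h1.symm
        omega
    | cast i =>
      induction j using Fin.lastCases with
      | last =>
        simp only [Fin.snoc_last, Fin.snoc_castSucc]
        intro h1 h2
        have := hlt i h1
        omega
      | cast j =>
        simp only [Fin.snoc_castSucc]
        intro h1 h2
        rw [h.inj i j h1 h2]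
  lt := by
    intro i
    induction i using Fin.lastCases with
    | last =>
      simp only [Fin.snoc_last]
      omega
    | cast i =>
      simp only [Fin.snoc_castSucc]
      have := h.lt i
      rw [Function.update_apply] at this
      split_ifs at this with hi
      · rw [hi]; omega
      · exact this
  surj := by
    intro b κ hκ
    by_cases hb : b = c ∧ κ = β c - 1
    · exact ⟨Fin.last n, by simp [hb.1], by simp [hb.2]⟩
    · obtain ⟨i, h1, h2⟩ := h.surj b κ (by
        rw [Function.update_apply]
        split_ifs with hbc
        · subst hbc
          simp only [true_and] at hb
          omega
        · exact hκ)
      exact ⟨i.castSucc, by simpa using h1, by simpa using h2⟩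

theorem tabFunctional_mul_X_pow_eq_zero {ι : Type*} [Fintype ι] [DecidableEq ι] {π lev : ι → ℕ}
    (h : IsFilling β π lev) (a : ι → ℕ) (l : ι) {s : ℕ} (hs : β (π l) ≤ a l + s)
    (g : MvPolynomial ι ℂ) : tabFunctional π lev a (g * MvPolynomial.X l ^ s) = 0 := by
  suffices hz : tabFunctional π lev a ∘ₗ LinearMap.mulRight ℂ (MvPolynomial.X l ^ s) = 0 from
    LinearMap.congr_fun hz g
  refine linearMap_ext_prod fun e => ?_
  have hp : (∏ i, MvPolynomial.X i ^ e i : MvPolynomial ι ℂ) * MvPolynomial.X l ^ s =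
      ∏ i, MvPolynomial.X i ^ (e i + if i = l then s else 0) := by
    simp only [pow_add, Finset.prod_mul_distrib, pow_ite, pow_zero, Finset.prod_ite_eq',
      Finset.mem_univ, if_true]
  rw [LinearMap.comp_apply, LinearMap.mulRight_apply, hp, tabFunctional_prod,
    LinearMap.zero_apply]
  refine Matrix.det_eq_zero_of_row_eq_zero l fun j => ?_
  rw [blockMatrix_apply, if_pos rfl]
  split_ifs with hj
  · rw [PowerSeries.coeff_X_pow, if_neg]
    have := h.lt j
    rw [← hj] at this
    omega
  · rfl

/-- The shift β c - 1 - j is chosen so that x_n^j turns the last row into the unit vector at the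
added bottom cell of column c; expansion along this row leaves the smaller determinant. -/
theorem tabFunctional_snoc (h : IsFilling (Function.update β c (β c - 1)) π lev) {j : ℕ}
    (hj : j < β c) (a : Fin n → ℕ) (g : MvPolynomial (Fin n) ℂ) :
    tabFunctional (Fin.snoc π c : Fin (n + 1) → ℕ) (Fin.snoc lev (β c - 1) : Fin (n + 1) → ℕ)
      (Fin.snoc a (β c - 1 - j) : Fin (n + 1) → ℕ)
      (MvPolynomial.X (Fin.last n) ^ j * MvPolynomial.rename Fin.castSucc g) =
    tabFunctional π lev a g := by
  suffices hz : tabFunctional (Fin.snoc π c : Fin (n + 1) → ℕ)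
      (Fin.snoc lev (β c - 1) : Fin (n + 1) → ℕ) (Fin.snoc a (β c - 1 - j) : Fin (n + 1) → ℕ) ∘ₗ
      LinearMap.mulLeft ℂ (MvPolynomial.X (Fin.last n) ^ j) ∘ₗ
      (MvPolynomial.rename Fin.castSucc).toLinearMap = tabFunctional π lev a from
    LinearMap.congr_fun hz g
  refine linearMap_ext_prod fun e => ?_
  have hp : (MvPolynomial.X (Fin.last n) ^ j * MvPolynomial.rename Fin.castSucc
      (∏ i, MvPolynomial.X i ^ e i) : MvPolynomial (Fin (n + 1)) ℂ) =
      ∏ i, MvPolynomial.X i ^ (Fin.snoc e j : Fin (n + 1) → ℕ) i := by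
    rw [Fin.prod_univ_castSucc, map_prod, mul_comm]
    simp
  rw [LinearMap.comp_apply, LinearMap.comp_apply, LinearMap.mulLeft_apply,
    AlgHom.toLinearMap_apply, hp, tabFunctional_prod, tabFunctional_prod,
    Matrix.det_succ_row _ (Fin.last n), Fin.sum_univ_castSucc, Finset.sum_eq_zero, zero_add]
  · rw [blockMatrix_apply, if_pos rfl, Fin.snoc_last, Fin.snoc_last, Fin.snoc_last,
      Nat.sub_add_cancel (by omega), PowerSeries.coeff_X_pow_self, ← two_mul,
      Even.neg_one_pow (even_two_mul _), one_mul, one_mul]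
    congr 1
    ext i i'
    simp [blockMatrix_apply]
  · intro i _
    rw [blockMatrix_apply, Fin.snoc_last, Fin.snoc_last, Fin.snoc_last, Fin.snoc_castSucc,
      Fin.snoc_castSucc, Nat.sub_add_cancel (by omega)]
    split_ifs with hi
    · rw [PowerSeries.coeff_X_pow, if_neg, mul_zero, zero_mul]
      have := h.lt i
      rw [← hi, Function.update_self] at this
      omega
    · rw [mul_zero, zero_mul]

/-- Every combination of filling functionals of the diagram with one cell removed is the leading
coefficient of a combination of filling functionals. -/
theorem exists_lift {j : ℕ} (hj : j < β c) {F : MvPolynomial (Fin n) ℂ →ₗ[ℂ] ℂ}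
    (hF : F ∈ Submodule.span ℂ (tabFunctionals (Fin n) (Function.update β c (β c - 1)))) :
    ∃ G ∈ Submodule.span ℂ (tabFunctionals (Fin (n + 1)) β),
      (∀ g, G (g * MvPolynomial.X (Fin.last n) ^ (j + 1)) = 0) ∧
      ∀ g, G (MvPolynomial.X (Fin.last n) ^ j * MvPolynomial.rename Fin.castSucc g) = F g := by
  induction hF using Submodule.span_induction with
  | mem F hF =>
    obtain ⟨π, lev, a, h, rfl⟩ := hF
    have h' := h.snoc (by omega)
    refine ⟨_, Submodule.subset_span ⟨_, _, _, h', rfl⟩, fun g => ?_,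
      fun g => tabFunctional_snoc h hj a g⟩
    refine tabFunctional_mul_X_pow_eq_zero h' _ _ ?_ g
    rw [Fin.snoc_last, Fin.snoc_last]
    omega
  | zero => exact ⟨0, zero_mem _, fun g => rfl, fun g => rfl⟩
  | add F F' _ _ hF hF' =>
    obtain ⟨G, hG, h1, h2⟩ := hF
    obtain ⟨G', hG', h1', h2'⟩ := hF'
    refine ⟨G + G', add_mem hG hG', fun g => ?_, fun g => ?_⟩
    · rw [LinearMap.add_apply, h1, h1', add_zero]
    · rw [LinearMap.add_apply, h2, h2', LinearMap.add_apply]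
  | smul r F _ hF =>
    obtain ⟨G, hG, h1, h2⟩ := hF
    refine ⟨r • G, Submodule.smul_mem _ _ hG, fun g => ?_, fun g => ?_⟩
    · rw [LinearMap.smul_apply, h1, smul_zero]
    · rw [LinearMap.smul_apply, h2, LinearMap.smul_apply]

end Lift

section Remove

variable {β : ℕ → ℕ} {c : ℕ}

theorem antitone_update_sub_one (hβ : Antitone β) (hc : β (c + 1) < β c) :
    Antitone (Function.update β c (β c - 1)) := by
  intro a b hab
  have h1 := hβ hab
  simp only [Function.update_apply]
  split_ifs with hb ha ha
  · exact le_rfl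
  · subst hb
    omega
  · subst ha
    have := hβ (show a + 1 ≤ b by omega)
    omega
  · exact h1

theorem sum_range_update_of_le {t : ℕ} (ht : t ≤ c) (v : ℕ) :
    ∑ i ∈ Finset.range t, Function.update β c v i = ∑ i ∈ Finset.range t, β i :=
  Finset.sum_update_of_notMem (by simpa using ht) _ _

theorem sum_range_update_of_lt {t : ℕ} (ht : c < t) (hc : 0 < β c) :
    ∑ i ∈ Finset.range t, Function.update β c (β c - 1) i + 1 = ∑ i ∈ Finset.range t, β i := by
  have hm : c ∈ Finset.range t := Finset.mem_range.mpr ht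
  rw [Finset.sum_update_of_mem hm, ← Finset.add_sum_erase _ _ hm, Finset.sdiff_singleton_eq_erase]
  omega

/-- Since β (c + 1) ≤ j < β c, the bottom cell of column c is a removable corner of the diagram. -/
theorem exists_last_column {j L : ℕ} (h0 : j < β 0) (hL : β (L + 1) ≤ j) :
    ∃ c, j < β c ∧ β (c + 1) ≤ j := by
  classical
  have hex : ∃ c, β (c + 1) ≤ j := ⟨L, hL⟩
  refine ⟨Nat.find hex, ?_, Nat.find_spec hex⟩
  rcases hc : Nat.find hex with _ | m
  · exact h0
  · have := Nat.find_min hex (show m < Nat.find hex by omega)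
    omega

end Remove

/-- The coefficient functional of the `j`-th power of the last variable. -/
def coeffLast {n : ℕ} (F : MvPolynomial (Fin (n + 1)) ℂ →ₗ[ℂ] ℂ) (j : ℕ) :
    MvPolynomial (Fin n) ℂ →ₗ[ℂ] ℂ :=
  F ∘ₗ LinearMap.mulLeft ℂ (MvPolynomial.X (Fin.last n) ^ j) ∘ₗ
    (MvPolynomial.rename Fin.castSucc).toLinearMap

theorem coeffLast_apply {n : ℕ} (F : MvPolynomial (Fin (n + 1)) ℂ →ₗ[ℂ] ℂ) (j : ℕ)
    (g : MvPolynomial (Fin n) ℂ) : coeffLast F j g =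
      F (MvPolynomial.X (Fin.last n) ^ j * MvPolynomial.rename Fin.castSucc g) := rfl

/-- Removing the cell creates a new condition only when c < |T| and r + |T| equals the old bound.
There, expand h_(r+j)(T ∪ {n}) in powers x_n^a: terms with a < j die by the old conditions on T,
terms with a > j by `hFj`, and so the term a = j dies as well. -/
theorem coeffLast_mem_harmonics {n j c : ℕ} {β : ℕ → ℕ}
    {F : MvPolynomial (Fin (n + 1)) ℂ →ₗ[ℂ] ℂ} (hF : F ∈ harmonics (Fin (n + 1)) β)
    (hFj : ∀ g, F (g * MvPolynomial.X (Fin.last n) ^ (j + 1)) = 0)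
    (hβ : Antitone β) (hc : j < β c) (hc' : β (c + 1) ≤ j) :
    coeffLast F j ∈ harmonics (Fin n) (Function.update β c (β c - 1)) := by
  intro T hT r hr g
  set T' := T.map Fin.castSuccEmb with hT'
  have hcard : T'.card = T.card := Finset.card_map _
  have hT'n : T'.Nonempty := hT.map
  have hlast : Fin.last n ∉ T' := by
    simp [hT', Fin.castSucc_ne_last]
  have hren : MvPolynomial.rename Fin.castSucc (hsum T r) = hsum T' r :=
    rename_hsum Fin.castSuccEmb T r
  rw [coeffLast_apply, map_mul (MvPolynomial.rename (R := ℂ) Fin.castSucc), hren, ← mul_assoc]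
  by_cases hlt : ∑ i ∈ Finset.range T'.card, β i < r + T'.card
  · exact hF T' hT'n r hlt _
  · rw [hcard] at hlt
    have hct : c < T.card := by
      by_contra hct
      rw [sum_range_update_of_le (by omega)] at hr
      exact hlt hr
    have hsum_eq := sum_range_update_of_lt (β := β) hct (by omega)
    have hβt : β T.card ≤ j := (hβ (show c + 1 ≤ T.card by omega)).trans hc'
    have hins : hsum (insert (Fin.last n) T') (r + j) ∈ ann F := by
      refine hF _ (Finset.insert_nonempty _ _) _ ?_
      rw [Finset.card_insert_of_notMem hlast, hcard, Finset.sum_range_succ]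
      omega
    have h0 := hins (MvPolynomial.rename Fin.castSucc g)
    rw [hsum_insert hlast, Finset.mul_sum, map_sum,
      Finset.sum_eq_single_of_mem (j, r)
        (Finset.HasAntidiagonal.mem_antidiagonal.mpr (add_comm j r))] at h0
    · rw [← h0]
      congr 1
      ring
    · rintro ⟨a, b⟩ hab hne
      rw [Finset.HasAntidiagonal.mem_antidiagonal] at hab
      simp only at hab ⊢
      rcases lt_trichotomy a j with h | h | h
      · rw [← mul_assoc]
        exact hF T' hT'n b (by rw [hcard]; omega) _
      · exact absurd (Prod.ext h (by simp only; omega)) hne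
      · obtain ⟨m, rfl⟩ : ∃ m, a = m + (j + 1) := ⟨a - (j + 1), by omega⟩
        rw [pow_add]
        convert hFj (MvPolynomial.rename Fin.castSucc g * MvPolynomial.X (Fin.last n) ^ m *
          hsum T' b) using 2
        ring

theorem eq_zero_on_mul_pow {n j : ℕ} {F : MvPolynomial (Fin (n + 1)) ℂ →ₗ[ℂ] ℂ}
    (hFj : ∀ g, F (g * MvPolynomial.X (Fin.last n) ^ (j + 1)) = 0)
    (hF0 : ∀ g, F (MvPolynomial.X (Fin.last n) ^ j * MvPolynomial.rename Fin.castSucc g) = 0)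
    (g : MvPolynomial (Fin (n + 1)) ℂ) : F (g * MvPolynomial.X (Fin.last n) ^ j) = 0 := by
  suffices hz : F ∘ₗ LinearMap.mulRight ℂ (MvPolynomial.X (Fin.last n) ^ j) = 0 from
    LinearMap.congr_fun hz g
  refine linearMap_ext_prod fun e => ?_
  rw [LinearMap.comp_apply, LinearMap.mulRight_apply, LinearMap.zero_apply,
    Fin.prod_univ_castSucc]
  rcases h : e (Fin.last n) with _ | m
  · refine Eq.trans (congrArg F ?_) (hF0 (∏ i, MvPolynomial.X i ^ e (Fin.castSucc i)))
    rw [map_prod, mul_comm]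
    simp
  · refine Eq.trans (congrArg F ?_) (hFj ((∏ i : Fin n, MvPolynomial.X i.castSucc ^ e i.castSucc) *
      MvPolynomial.X (Fin.last n) ^ m))
    ring

/-- Every functional satisfying the vanishing conditions attached to the column lengths `β` is a
combination of functionals attached to fillings. -/
theorem harmonics_le_span (L n : ℕ) (β : ℕ → ℕ) (hβ : Antitone β) (hL : ∀ c, L ≤ c → β c = 0)
    (hn : ∑ c ∈ Finset.range L, β c = n) :
    harmonics (Fin n) β ≤ Submodule.span ℂ (tabFunctionals (Fin n) β) := by
  induction n generalizing β with
  | zero =>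
    intro F _
    have hβ0 : ∀ c, β c = 0 := fun c => by
      by_cases hc : c < L
      · exact Finset.sum_eq_zero_iff.mp hn c (Finset.mem_range.mpr hc)
      · exact hL c (by omega)
    have hfill : IsFilling β (Fin.elim0 : Fin 0 → ℕ) Fin.elim0 :=
      ⟨fun i => i.elim0, fun i => i.elim0, fun c κ h => by rw [hβ0] at h; omega⟩
    have : F = F 1 • tabFunctional Fin.elim0 Fin.elim0 Fin.elim0 := by
      refine linearMap_ext_prod fun e => ?_
      rw [LinearMap.smul_apply, tabFunctional_prod]
      simp
    rw [this]
    exact Submodule.smul_mem _ _ (Submodule.subset_span ⟨_, _, _, hfill, rfl⟩)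
  | succ n ih =>
    -- The induction is on the power of the last variable that annihilates F: subtracting a lift of
    -- the coefficient functional of x_n^j lowers this power from j + 1 to j.
    have key : ∀ J ≤ β 0, ∀ F ∈ harmonics (Fin (n + 1)) β,
        (∀ g, F (g * MvPolynomial.X (Fin.last n) ^ J) = 0) →
        F ∈ Submodule.span ℂ (tabFunctionals (Fin (n + 1)) β) := by
      intro J
      induction J with
      | zero =>
        intro _ F _ hF
        have : F = 0 := by
          ext g
          simpa using hF _
        rw [this]
        exact zero_mem _
      | succ j ihj =>
        intro hj F hF hFj
        obtain ⟨c, hc, hc'⟩ := exists_last_column (β := β) (j := j) (L := L) (by omega)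
          (by rw [hL _ (by omega)]; omega)
        have hcL : c < L := by
          by_contra h
          rw [hL c (by omega)] at hc
          omega
        have hlead := ih (Function.update β c (β c - 1)) (antitone_update_sub_one hβ (by omega))
          (by
            intro b hb
            rw [Function.update_of_ne (by omega)]
            exact hL b hb)
          (by
            have := sum_range_update_of_lt (β := β) hcL (by omega)
            omega)
          (coeffLast_mem_harmonics hF hFj hβ hc hc')
        obtain ⟨G, hG, hG1, hG2⟩ := exists_lift hc hlead
        have hsub : F - G ∈ Submodule.span ℂ (tabFunctionals (Fin (n + 1)) β) := by
          refine ihj (by omega) _ (sub_mem hF (span_tabFunctionals_le_harmonics hβ hG)) ?_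
          refine eq_zero_on_mul_pow (fun g => ?_) fun g => ?_
          · rw [LinearMap.sub_apply, hFj, hG1, sub_zero]
          · rw [LinearMap.sub_apply, hG2, coeffLast_apply, sub_self]
        simpa using add_mem hsub hG
    intro F hF
    refine key (β 0) le_rfl F hF fun g => ?_
    -- For a one-element T the condition says that x^r annihilates F for r ≥ β 0, which starts the
    -- descent.
    rw [← hsum_singleton]
    exact hF _ (Finset.singleton_nonempty _) _ (by simp) g

/-! ### Determinants of generic series. -/

theorem derivAtZero_eq (α : PowerSeries ℂ) (m : ℕ) :
    derivAtZero α m = (m ! : ℂ) * PowerSeries.coeff m α := by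
  rw [derivAtZero, ← PowerSeries.coeff_zero_eq_constantCoeff_apply,
    PowerSeries.coeff_iterate_derivative]
  simp [Nat.one_ascFactorial]

/-- The generic series `∑ X_i^(j) T^j / j!`. -/
def genericSeries (N : ℕ) (i : Fin (N + 1)) : PowerSeries (V N) :=
  PowerSeries.mk fun j => MvPolynomial.C ((j ! : ℂ)⁻¹) * MvPolynomial.X (i, j)

theorem coeff_genericSeries (N : ℕ) (i : Fin (N + 1)) (j : ℕ) :
    PowerSeries.coeff j (genericSeries N i) =
      MvPolynomial.C ((j ! : ℂ)⁻¹) * MvPolynomial.X (i, j) :=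
  PowerSeries.coeff_mk _ _

theorem act_X (N : ℕ) (α : (PowerSeries ℂ)ˣ) (p : Fin (N + 1) × ℕ) :
    act N α (MvPolynomial.X p) = leibniz N (α : PowerSeries ℂ) p.1 p.2 := by
  rw [act, MvPolynomial.aeval_X]

theorem act_C (N : ℕ) (α : (PowerSeries ℂ)ˣ) (c : ℂ) :
    act N α (MvPolynomial.C c) = MvPolynomial.C c := by
  rw [act, MvPolynomial.aeval_C]
  rfl

/-- Division by j! turns the Leibniz rule into multiplication of Taylor series. -/
theorem map_act_genericSeries (N : ℕ) (α : (PowerSeries ℂ)ˣ) (i : Fin (N + 1)) :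
    PowerSeries.map (act N α).toRingHom (genericSeries N i) =
      genericSeries N i * PowerSeries.map MvPolynomial.C (α : PowerSeries ℂ) := by
  ext1 j
  rw [PowerSeries.coeff_map, coeff_genericSeries, PowerSeries.coeff_mul,
    Finset.Nat.sum_antidiagonal_eq_sum_range_succ_mk]
  change act N α _ = _
  rw [map_mul, act_C, act_X, leibniz, Finset.mul_sum]
  refine Finset.sum_congr rfl fun l hl => ?_
  have hl' : l ≤ j := Nat.lt_succ_iff.mp (Finset.mem_range.mp hl)
  rw [coeff_genericSeries, PowerSeries.coeff_map, derivAtZero_eq, MvPolynomial.smul_eq_C_mul,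
    ← mul_assoc, ← map_mul, mul_right_comm, ← map_mul]
  congr 2
  have h1 : (l ! : ℂ) ≠ 0 := by exact_mod_cast l.factorial_ne_zero
  have h2 : (j ! : ℂ) ≠ 0 := by exact_mod_cast j.factorial_ne_zero
  have h3 : (j.choose l : ℂ) * l ! * (j - l)! = j ! := by
    exact_mod_cast Nat.choose_mul_factorial_mul_factorial hl'
  field_simp
  rw [← h3]
  ring

/-- The determinant of the first `b` coefficients of `b` shifted generic series. -/
def detPoly (N b : ℕ) (w : Fin b → Fin (N + 1)) (a : Fin b → ℕ) : V N :=
  (blockMatrix (fun _ => 0) Fin.val fun i =>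
    (PowerSeries.X : PowerSeries (V N)) ^ a i * genericSeries N (w i)).det

theorem isFilling_val (b : ℕ) :
    IsFilling (fun c => if c = 0 then b else 0) (fun _ : Fin b => 0) Fin.val where
  inj := fun i j _ h => Fin.ext h
  lt := fun i => by simp
  surj := by
    intro c κ h
    split_ifs at h with hc
    · exact ⟨⟨κ, h⟩, hc.symm, rfl⟩
    · omega

theorem detPoly_mem_VDiff (N b : ℕ) (w : Fin b → Fin (N + 1)) (a : Fin b → ℕ) :
    detPoly N b w a ∈ VDiff N b := by
  intro α
  have h := det_blockMatrix_mul (isFilling_val b)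
    (fun _ => PowerSeries.map MvPolynomial.C (α : PowerSeries ℂ))
    fun i => (PowerSeries.X : PowerSeries (V N)) ^ a i * genericSeries N (w i)
  have h1 : act N α (detPoly N b w a) = (act N α).toRingHom (detPoly N b w a) := rfl
  rw [h1, detPoly, RingHom.map_det, RingHom.mapMatrix_apply, map_blockMatrix]
  simp only [map_mul, map_pow, PowerSeries.map_X, map_act_genericSeries, ← mul_assoc]
  rw [h, MvPolynomial.smul_eq_C_mul, mul_comm, Finset.prod_const, Finset.card_univ,
    Fintype.card_fin, ← PowerSeries.coeff_zero_eq_constantCoeff_apply, PowerSeries.coeff_map,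
    PowerSeries.coeff_zero_eq_constantCoeff_apply, map_pow]

theorem detPoly_mem_orderLE (N b : ℕ) (w : Fin b → Fin (N + 1)) (a : Fin b → ℕ) :
    detPoly N b w a ∈ orderLE N ((b : ℤ) - 1) := by
  rw [detPoly, Matrix.det_apply]
  refine sum_mem fun σ _ => ?_
  rw [Units.smul_def]
  refine zsmul_mem (prod_mem fun i _ => ?_) _
  rw [blockMatrix_apply, if_pos rfl, PowerSeries.coeff_X_pow_mul']
  split_ifs with h
  · rw [coeff_genericSeries]
    refine mul_mem (Subalgebra.algebraMap_mem _ _) (Algebra.subset_adjoin ⟨_, ?_, rfl⟩)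
    have := i.2
    simp only [Set.mem_ofPred_eq]
    omega
  · exact zero_mem _

theorem detPoly_eq_zero {N b : ℕ} {w : Fin b → Fin (N + 1)} {a : Fin b → ℕ} {i : Fin b}
    (hi : b ≤ a i) : detPoly N b w a = 0 := by
  refine Matrix.det_eq_zero_of_row_eq_zero i fun j => ?_
  rw [blockMatrix_apply, if_pos rfl, PowerSeries.coeff_X_pow_mul', if_neg]
  have := j.2
  omega

/-- The determinants of size at most `k + 1`. -/
def detPolys (N k : ℕ) : Set (V N) :=
  {P | ∃ b ≤ k + 1, ∃ (w : Fin b → Fin (N + 1)) (a : Fin b → ℕ), P = detPoly N b w a}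

theorem detPolys_finite (N k : ℕ) : (detPolys N k).Finite := by
  refine Set.Finite.subset ((Set.finite_range fun p : Σ b : Fin (k + 2),
    (Fin b → Fin (N + 1)) × (Fin b → Fin (k + 1)) =>
      detPoly N p.1 p.2.1 fun i => p.2.2 i).union (Set.finite_singleton 0)) ?_
  rintro _ ⟨b, hb, w, a, rfl⟩
  by_cases h : ∃ i, b ≤ a i
  · obtain ⟨i, hi⟩ := h
    exact Or.inr (detPoly_eq_zero hi)
  · push Not at h
    exact Or.inl ⟨⟨⟨b, by omega⟩, w, fun i => ⟨a i, (h i).trans_le hb⟩⟩, rfl⟩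

/-- The matrix is block diagonal along the columns of the diagram; each column, reindexed by level,
contributes a `detPoly` of size β c. -/
theorem det_blockMatrix_mem_adjoin {N k n : ℕ} {β : ℕ → ℕ} {π lev : Fin n → ℕ}
    (h : IsFilling β π lev) (hk : ∀ c, β c ≤ k + 1) (w : Fin n → Fin (N + 1)) (a : Fin n → ℕ) :
    (blockMatrix π lev fun i =>
      (PowerSeries.X : PowerSeries (V N)) ^ a i * genericSeries N (w i)).det ∈
    Algebra.adjoin ℂ (detPolys N k) := by
  set M := blockMatrix π lev fun i =>
    (PowerSeries.X : PowerSeries (V N)) ^ a i * genericSeries N (w i) with hM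
  have htri : M.BlockTriangular π := by
    intro i j hij
    exact if_neg hij.ne'
  rw [htri.det]
  refine prod_mem fun c _ => Algebra.subset_adjoin ?_
  let e : {i // π i = c} ≃ Fin (β c) := Equiv.ofBijective
    (fun i => ⟨lev i, (h.lt i).trans_eq (congrArg β i.2)⟩)
    ⟨fun i j hij => Subtype.ext (h.inj i j (i.2.trans j.2.symm) (congrArg Fin.val hij)),
      fun κ => by
        obtain ⟨i, h1, h2⟩ := h.surj c κ κ.2
        exact ⟨⟨i, h1⟩, Fin.ext h2⟩⟩
  refine ⟨β c, hk c, fun i => w (e.symm i), fun i => a (e.symm i), ?_⟩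
  rw [detPoly, ← Matrix.det_submatrix_equiv_self e]
  congr 1
  ext1 i j
  rw [Matrix.submatrix_apply, blockMatrix_apply, if_pos rfl]
  simp only [Equiv.symm_apply_apply]
  exact if_pos (i.2.trans j.2.symm)

/-! ### The apolar pairing and complete polarization. -/

section Pairing

variable {σ : Type*}

/-- The apolar functional `Q ↦ Q(∂)P` at the origin. -/
def pairing (P : MvPolynomial σ ℂ) : MvPolynomial σ ℂ →ₗ[ℂ] ℂ :=
  (MvPolynomial.basisMonomials σ ℂ).constr ℂ fun m =>
    (m.prod fun _ k => (k ! : ℂ)) * MvPolynomial.coeff m P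

theorem pairing_monomial (P : MvPolynomial σ ℂ) (m : σ →₀ ℕ) (c : ℂ) :
    pairing P (MvPolynomial.monomial m c) =
      c * ((m.prod fun _ k => (k ! : ℂ)) * MvPolynomial.coeff m P) := by
  have h := (MvPolynomial.basisMonomials σ ℂ).constr_basis ℂ
    (fun m => (m.prod fun _ k => (k ! : ℂ)) * MvPolynomial.coeff m P) m
  rw [MvPolynomial.coe_basisMonomials] at h
  have hm : MvPolynomial.monomial m c = c • MvPolynomial.monomial m (1 : ℂ) := by
    rw [MvPolynomial.smul_monomial, smul_eq_mul, mul_one]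
  rw [hm, map_smul, smul_eq_mul]
  exact congrArg _ h

theorem pairing_C (P : MvPolynomial σ ℂ) (c : ℂ) :
    pairing P (MvPolynomial.C c) = c * MvPolynomial.constantCoeff P := by
  rw [← MvPolynomial.monomial_zero', pairing_monomial, Finsupp.prod_zero_index, one_mul,
    MvPolynomial.constantCoeff_eq]

theorem pairing_sub (P P' Q : MvPolynomial σ ℂ) :
    pairing (P - P') Q = pairing P Q - pairing P' Q := by
  induction Q using MvPolynomial.induction_on' with
  | monomial m c => simp only [pairing_monomial, MvPolynomial.coeff_sub]; ring
  | add p q hp hq => simp only [map_add, hp, hq]; ring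

theorem pairing_C_mul (P Q : MvPolynomial σ ℂ) (a : ℂ) :
    pairing (MvPolynomial.C a * P) Q = a * pairing P Q := by
  induction Q using MvPolynomial.induction_on' with
  | monomial m c => simp only [pairing_monomial, MvPolynomial.coeff_C_mul]; ring
  | add p q hp hq => simp only [map_add, hp, hq]; ring

theorem pairing_X_mul (P Q : MvPolynomial σ ℂ) (u : σ) :
    pairing P (MvPolynomial.X u * Q) = pairing (MvPolynomial.pderiv u P) Q := by
  classical
  induction Q using MvPolynomial.induction_on' with
  | monomial m c =>
    rw [mul_comm, MvPolynomial.X, MvPolynomial.monomial_mul, pairing_monomial, pairing_monomial,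
      MvPolynomial.coeff_pderiv, mul_one]
    have h : ((m + Finsupp.single u 1).prod fun _ k => (k ! : ℂ)) =
        (m.prod fun _ k => (k ! : ℂ)) * (m u + 1) := by
      have hins : ∀ f : σ →₀ ℕ, f.support ⊆ insert u m.support →
          (f.prod fun _ k => (k ! : ℂ)) =
            (f u)! * ∏ i ∈ m.support.erase u, ((f i)! : ℂ) := by
        intro f hf
        rw [Finsupp.prod_of_support_subset _ hf _ (by simp),
          ← Finset.mul_prod_erase _ _ (Finset.mem_insert_self u _), Finset.erase_insert_eq_erase]
      rw [hins m (Finset.subset_insert _ _), hins (m + Finsupp.single u 1)]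
      · rw [Finsupp.add_apply, Finsupp.single_eq_same, Nat.factorial_succ]
        have : ∀ i ∈ m.support.erase u, (((m + Finsupp.single u 1 : σ →₀ ℕ) i)! : ℂ) = ((m i)! : ℂ) := by
          intro i hi
          rw [Finsupp.add_apply, Finsupp.single_eq_of_ne (Finset.ne_of_mem_erase hi), add_zero]
        rw [Finset.prod_congr rfl this]
        push_cast
        ring
      · intro i hi
        by_cases hiu : i = u
        · simp [hiu]
        · simpa [hiu, Finsupp.single_apply, Ne.symm hiu] using hi
    rw [h]
    ring
  | add p q hp hq => rw [mul_add, map_add, map_add, hp, hq]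

theorem coeff_X_mul_pderiv (P : MvPolynomial σ ℂ) (u : σ) (m : σ →₀ ℕ) :
    MvPolynomial.coeff m (MvPolynomial.X u * MvPolynomial.pderiv u P) =
      m u * MvPolynomial.coeff m P := by
  classical
  rw [MvPolynomial.coeff_X_mul', MvPolynomial.coeff_pderiv]
  split_ifs with h
  · have h1 : Finsupp.single u 1 ≤ m := by
      rw [Finsupp.single_le_iff]
      exact Nat.one_le_iff_ne_zero.mpr (Finsupp.mem_support_iff.mp h)
    rw [tsub_add_cancel_of_le h1, mul_comm]
    congr 1
    have := DFunLike.congr_fun (tsub_add_cancel_of_le h1) u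
    rw [Finsupp.add_apply, Finsupp.single_eq_same] at this
    exact_mod_cast this
  · rw [Finsupp.notMem_support_iff.mp h, Nat.cast_zero, zero_mul]

/-- Euler's identity for polynomials in finitely many of the variables. -/
theorem sum_X_mul_pderiv_of_mem_supported {I : Type*} [Fintype I] {f : I → σ}
    (hf : Function.Injective f) {d : ℕ} {P : MvPolynomial σ ℂ} (hP : P.IsHomogeneous d)
    (hs : P ∈ MvPolynomial.supported ℂ (Set.range f)) :
    ∑ v, MvPolynomial.X (f v) * MvPolynomial.pderiv (f v) P = MvPolynomial.C (d : ℂ) * P := by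
  classical
  ext m
  rw [MvPolynomial.coeff_sum, MvPolynomial.coeff_C_mul]
  simp only [coeff_X_mul_pderiv, ← Finset.sum_mul]
  by_cases hm : MvPolynomial.coeff m P = 0
  · rw [hm, mul_zero, mul_zero]
  · congr 1
    have hd : m.degree = d := by
      rw [Finsupp.degree_eq_weight_one]
      exact hP hm
    rw [← hd, Finsupp.degree, ← Nat.cast_sum, Nat.cast_inj]
    symm
    change ∑ i ∈ m.support, m i = _
    rw [← Finset.sum_image (s := Finset.univ) (g := f) (f := m) hf.injOn]
    refine Finset.sum_subset ?_ ?_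
    · intro i hi
      have := MvPolynomial.mem_supported.mp hs
        (Finset.mem_coe.mpr ((MvPolynomial.mem_vars_iff_mem_support i).mpr
          ⟨m, MvPolynomial.mem_support_iff.mpr hm, hi⟩))
      simpa using this
    · intro i _ hi
      exact Finsupp.notMem_support_iff.mp hi

theorem pderiv_mem_supported {S : Set σ} {P : MvPolynomial σ ℂ}
    (hP : P ∈ MvPolynomial.supported ℂ S) (u : σ) :
    MvPolynomial.pderiv u P ∈ MvPolynomial.supported ℂ S := by
  classical
  rw [MvPolynomial.mem_supported] at hP ⊢
  intro i hi
  obtain ⟨m, hm, him⟩ := (MvPolynomial.mem_vars_iff_mem_support i).mp hi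
  rw [MvPolynomial.mem_support_iff, MvPolynomial.coeff_pderiv] at hm
  refine hP ((MvPolynomial.mem_vars_iff_mem_support i).mpr
    ⟨m + Finsupp.single u 1, MvPolynomial.mem_support_iff.mpr (left_ne_zero_of_mul hm), ?_⟩)
  rw [Finsupp.mem_support_iff] at him ⊢
  rw [Finsupp.add_apply]
  omega

/-- A homogeneous polynomial is recovered from its complete polarization. -/
theorem factorial_mul_eq_sum_pairing {I : Type*} [Fintype I] {f : I → σ}
    (hf : Function.Injective f) {d : ℕ} {P : MvPolynomial σ ℂ} (hP : P.IsHomogeneous d)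
    (hs : P ∈ MvPolynomial.supported ℂ (Set.range f)) :
    MvPolynomial.C (d ! : ℂ) * P = ∑ u : Fin d → I,
      MvPolynomial.C (pairing P (∏ b, MvPolynomial.X (f (u b)))) *
        ∏ b, MvPolynomial.X (f (u b)) := by
  induction d generalizing P with
  | zero =>
    have h0 : P = MvPolynomial.C (MvPolynomial.coeff 0 P) :=
      (MvPolynomial.totalDegree_eq_zero_iff_eq_C).mp
        ((MvPolynomial.totalDegree_zero_iff_isHomogeneous σ).mpr hP)
    have h1 := pairing_C P 1
    rw [MvPolynomial.C_1, one_mul, MvPolynomial.constantCoeff_eq] at h1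
    simp only [Finset.univ_eq_empty, Finset.prod_empty, h1, Finset.univ_unique,
      Finset.sum_singleton, mul_one, ← h0]
    simp
  | succ d ih =>
    have hE := sum_X_mul_pderiv_of_mem_supported hf hP hs
    rw [← (Fin.consEquiv fun _ => I).sum_comp, Fintype.sum_prod_type, Nat.factorial_succ,
      Nat.cast_mul, mul_comm (((d + 1 : ℕ) : ℂ)), map_mul, mul_assoc, ← hE, Finset.mul_sum]
    refine Finset.sum_congr rfl fun v _ => ?_
    rw [mul_left_comm, ih (by simpa using hP.pderiv) (pderiv_mem_supported hs _), Finset.mul_sum]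
    refine Finset.sum_congr rfl fun u _ => ?_
    simp only [Fin.consEquiv_apply, Fin.prod_univ_succ, Fin.cons_zero, Fin.cons_succ,
      pairing_X_mul]
    ring

end Pairing

/-! ### Homogeneity, and the transpose of the action of 1 - zT. -/

section Invariance

variable {N : ℕ}

theorem isHomogeneous_of_mem_VDiff {d : ℕ} {P : V N} (hP : P ∈ VDiff N d) :
    P.IsHomogeneous d := by
  -- The constant series 2 suffices: it scales the component of degree e by 2^e, and these factors
  -- are distinct.
  let α : (PowerSeries ℂ)ˣ :=
    Units.map (PowerSeries.C (R := ℂ)).toMonoidHom (Units.mk0 (2 : ℂ) two_ne_zero)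
  have hα : (α : PowerSeries ℂ) = PowerSeries.C 2 := rfl
  have hX : ∀ p : Fin (N + 1) × ℕ,
      leibniz N (α : PowerSeries ℂ) p.1 p.2 = MvPolynomial.C 2 * MvPolynomial.X p := by
    intro p
    rw [leibniz, Finset.sum_range_succ, Finset.sum_eq_zero, zero_add, derivAtZero_eq, hα]
    · simp [MvPolynomial.smul_eq_C_mul]
    · intro j hj
      have : p.2 - j ≠ 0 := by
        have := Finset.mem_range.mp hj
        omega
      rw [derivAtZero_eq, hα, PowerSeries.coeff_C, if_neg this, mul_zero, mul_zero, zero_smul]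
  have hcoeff : ∀ (Q : V N) (m : Fin (N + 1) × ℕ →₀ ℕ),
      MvPolynomial.coeff m (act N α Q) = 2 ^ m.degree * MvPolynomial.coeff m Q := by
    classical
    intro Q m
    induction Q using MvPolynomial.induction_on' with
    | monomial l c =>
      have : act N α (MvPolynomial.monomial l c) =
          MvPolynomial.C (2 ^ l.degree) * MvPolynomial.monomial l c := by
        rw [MvPolynomial.monomial_eq, map_mul, act_C, Finsupp.prod, map_prod]
        simp only [map_pow, act_X, hX, mul_pow, Finset.prod_mul_distrib]
        rw [Finset.prod_pow_eq_pow_sum]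
        change _ * (MvPolynomial.C 2 ^ l.degree * _) = _
        ring
      rw [this, MvPolynomial.coeff_C_mul, MvPolynomial.coeff_monomial]
      split_ifs with h
      · rw [h]
      · rw [mul_zero, mul_zero]
    | add p q hp hq => rw [map_add, MvPolynomial.coeff_add, hp, hq, MvPolynomial.coeff_add, mul_add]
  intro m hm
  have h := hcoeff P m
  rw [hP α, MvPolynomial.coeff_smul, smul_eq_mul, hα, PowerSeries.constantCoeff_C] at h
  have h2 := mul_right_cancel₀ hm h
  have h3 : (2 : ℕ) ^ d = 2 ^ m.degree := by exact_mod_cast h2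
  have h4 : m.degree = d := (Nat.pow_right_injective le_rfl h3).symm
  rw [Finsupp.degree_eq_weight_one] at h4
  exact h4

/-- The invertible series `1 - zT`. -/
def oneSub (z : ℂ) : (PowerSeries ℂ)ˣ :=
  Units.mkOfMulEqOne (1 - PowerSeries.C z * PowerSeries.X) (PowerSeries.mk fun a => z ^ a)
    (by rw [mul_comm, mk_pow_mul_one_sub])

theorem coe_oneSub (z : ℂ) :
    (oneSub z : PowerSeries ℂ) = 1 - PowerSeries.C z * PowerSeries.X := rfl

theorem constantCoeff_oneSub (z : ℂ) :
    PowerSeries.constantCoeff (oneSub z : PowerSeries ℂ) = 1 := by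
  simp [coe_oneSub]

theorem leibniz_oneSub_zero (z : ℂ) (i : Fin (N + 1)) :
    leibniz N (oneSub z : PowerSeries ℂ) i 0 = MvPolynomial.X (i, 0) := by
  rw [leibniz, Finset.sum_range_one, derivAtZero_eq]
  simp [constantCoeff_oneSub]

theorem leibniz_oneSub_succ (z : ℂ) (i : Fin (N + 1)) (j : ℕ) :
    leibniz N (oneSub z : PowerSeries ℂ) i (j + 1) =
      MvPolynomial.X (i, j + 1) - MvPolynomial.C ((j + 1) * z) * MvPolynomial.X (i, j) := by
  rw [leibniz, Finset.sum_range_succ, Finset.sum_range_succ, Finset.sum_eq_zero]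
  · have h1 : j + 1 - j = 1 := by omega
    rw [zero_add, derivAtZero_eq, derivAtZero_eq, h1, Nat.sub_self,
      PowerSeries.coeff_zero_eq_constantCoeff_apply, constantCoeff_oneSub, coe_oneSub]
    simp [MvPolynomial.smul_eq_C_mul, PowerSeries.coeff_one]
    ring
  · intro l hl
    obtain ⟨m, hm⟩ : ∃ m, j + 1 - l = m + 2 :=
      ⟨j - l - 1, by have := Finset.mem_range.mp hl; omega⟩
    rw [derivAtZero_eq, hm, coe_oneSub]
    simp [PowerSeries.coeff_one]

theorem pderiv_leibniz_oneSub (z : ℂ) (i : Fin (N + 1)) (j : ℕ) (p : Fin (N + 1) × ℕ) :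
    MvPolynomial.pderiv (i, j) (leibniz N (oneSub z : PowerSeries ℂ) p.1 p.2) =
      MvPolynomial.C ((if p = (i, j) then 1 else 0) -
        (j + 1) * z * if p = (i, j + 1) then 1 else 0) := by
  classical
  obtain ⟨i', j'⟩ := p
  cases j' with
  | zero =>
    rw [leibniz_oneSub_zero, MvPolynomial.pderiv_X]
    by_cases h : (i', 0) = (i, j)
    · rw [← h]
      simp
    · simp [h, Prod.ext_iff]
  | succ j' =>
    rw [leibniz_oneSub_succ, map_sub, MvPolynomial.pderiv_C_mul, MvPolynomial.pderiv_X,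
      MvPolynomial.pderiv_X]
    simp only [Pi.single_apply, map_sub, map_mul, apply_ite MvPolynomial.C, map_one, map_zero,
      Prod.mk.injEq, Nat.succ_inj]
    by_cases hi : i' = i ∧ j' = j
    · simp [hi]
    · simp [hi]

/-- This is the chain rule: X_i^(j) occurs only in the images of X_i^(j) and of X_i^(j+1), in the
latter with coefficient -(j+1)z. -/
theorem pderiv_act_oneSub (z : ℂ) (i : Fin (N + 1)) (j : ℕ) (P : V N) :
    MvPolynomial.pderiv (i, j) (act N (oneSub z) P) =
      act N (oneSub z) (MvPolynomial.pderiv (i, j) P -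
        MvPolynomial.C ((j + 1) * z) * MvPolynomial.pderiv (i, j + 1) P) := by
  classical
  induction P using MvPolynomial.induction_on with
  | C a => simp
  | add p q hp hq =>
    rw [map_add, map_add, hp, hq]
    simp only [map_add, map_sub, map_mul]
    ring
  | mul_X p u hp =>
    rw [map_mul, MvPolynomial.pderiv_mul, hp, act_X, pderiv_leibniz_oneSub,
      MvPolynomial.pderiv_mul, MvPolynomial.pderiv_mul, MvPolynomial.pderiv_X,
      MvPolynomial.pderiv_X]
    simp only [Pi.single_apply]
    split_ifs <;>
    · simp only [map_sub, map_mul, map_add, act_C, act_X, map_one, map_zero, mul_zero, mul_one]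
      ring

/-- The transpose of the action of `1 - zT`. -/
def actTranspose (N : ℕ) (z : ℂ) : V N →ₐ[ℂ] V N :=
  MvPolynomial.aeval fun p : Fin (N + 1) × ℕ =>
    (MvPolynomial.X p - MvPolynomial.C ((p.2 + 1) * z) * MvPolynomial.X (p.1, p.2 + 1) : V N)

theorem actTranspose_X (z : ℂ) (p : Fin (N + 1) × ℕ) :
    actTranspose N z (MvPolynomial.X p) =
      MvPolynomial.X p - MvPolynomial.C ((p.2 + 1) * z) * MvPolynomial.X (p.1, p.2 + 1) := by
  rw [actTranspose, MvPolynomial.aeval_X]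

theorem actTranspose_C (z c : ℂ) :
    actTranspose N z (MvPolynomial.C c) = MvPolynomial.C c := by
  rw [actTranspose, MvPolynomial.aeval_C]
  rfl

theorem constantCoeff_act (α : (PowerSeries ℂ)ˣ) (P : V N) :
    MvPolynomial.constantCoeff (act N α P) = MvPolynomial.constantCoeff P := by
  induction P using MvPolynomial.induction_on with
  | C a => rw [act_C]
  | add p q hp hq => rw [map_add, map_add, hp, hq, map_add]
  | mul_X p u hp =>
    rw [map_mul, map_mul, act_X, leibniz, map_sum, Finset.sum_eq_zero]
    · simp
    · intro j _
      simp

theorem pairing_act_oneSub (z : ℂ) (P Q : V N) :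
    pairing (act N (oneSub z) P) Q = pairing P (actTranspose N z Q) := by
  induction Q using MvPolynomial.induction_on generalizing P with
  | C a => rw [actTranspose_C, pairing_C, pairing_C, constantCoeff_act]
  | add p q hp hq => rw [map_add, map_add, map_add, hp, hq]
  | mul_X p u hp =>
    obtain ⟨i, j⟩ := u
    rw [mul_comm, pairing_X_mul, pderiv_act_oneSub, hp, map_mul (actTranspose N z), actTranspose_X, pairing_sub,
      pairing_C_mul, sub_mul, map_sub, pairing_X_mul,
      ← MvPolynomial.smul_eq_C_mul, smul_mul_assoc, map_smul, pairing_X_mul, smul_eq_mul]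

end Invariance

/-! ### Polarizations as functionals, and generation by determinants. -/

section Polarization

variable {N d : ℕ}

/-- The linear map `x^e ↦ ∏_b e_b! X_{w b}^(e b)`. -/
def substWord (w : Fin d → Fin (N + 1)) : MvPolynomial (Fin d) ℂ →ₗ[ℂ] V N :=
  (MvPolynomial.basisMonomials (Fin d) ℂ).constr ℂ fun e =>
    ∏ b, (MvPolynomial.C ((e b)! : ℂ) * MvPolynomial.X (w b, e b))

theorem substWord_prod (w : Fin d → Fin (N + 1)) (e : Fin d → ℕ) :
    substWord w (∏ b, MvPolynomial.X b ^ e b) =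
      ∏ b, (MvPolynomial.C ((e b)! : ℂ) * MvPolynomial.X (w b, e b)) := by
  have h := monomial_one_eq_prod (Finsupp.equivFunOnFinite.symm e)
  simp only [Finsupp.equivFunOnFinite_symm_apply_apply] at h
  have hb := (MvPolynomial.basisMonomials (Fin d) ℂ).constr_basis ℂ (fun e : Fin d →₀ ℕ =>
    ∏ b, (MvPolynomial.C ((e b)! : ℂ) * MvPolynomial.X (w b, e b) : V N))
    (Finsupp.equivFunOnFinite.symm e)
  rw [MvPolynomial.coe_basisMonomials] at hb
  rw [← h]
  exact hb

/-- The factorials in `substWord` absorb the factor j + 1 of `actTranspose`: e! X^(e) ↦ e! X^(e) - z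
(e+1)! X^(e+1) is multiplication of x^e by 1 - zx. -/
theorem substWord_mul_prod (w : Fin d → Fin (N + 1)) (z : ℂ) (g : MvPolynomial (Fin d) ℂ) :
    substWord w (g * ∏ i, (1 - MvPolynomial.C z * MvPolynomial.X i)) =
      actTranspose N z (substWord w g) := by
  suffices hs : substWord w ∘ₗ LinearMap.mulRight ℂ
      (∏ i, (1 - MvPolynomial.C z * MvPolynomial.X i)) =
      (actTranspose N z).toLinearMap ∘ₗ substWord w from LinearMap.congr_fun hs g
  refine linearMap_ext_prod fun e => ?_
  rw [LinearMap.comp_apply, LinearMap.comp_apply, LinearMap.mulRight_apply,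
    AlgHom.toLinearMap_apply, substWord_prod, map_prod]
  let y : ℕ → ℂ := fun κ => if κ = 0 then 1 else -z
  have h1 : ∀ i : Fin d, (1 - MvPolynomial.C z * MvPolynomial.X i : MvPolynomial (Fin d) ℂ) =
      ∑ κ ∈ Finset.range 2, MvPolynomial.C (y κ) * MvPolynomial.X i ^ κ := by
    intro i
    rw [Finset.sum_range_succ, Finset.sum_range_one]
    simp [y, sub_eq_add_neg]
  have h2 : ∀ b : Fin d, actTranspose N z
      (MvPolynomial.C ((e b)! : ℂ) * MvPolynomial.X (w b, e b)) =
      ∑ κ ∈ Finset.range 2, MvPolynomial.C (y κ) *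
        (MvPolynomial.C ((e b + κ)! : ℂ) * MvPolynomial.X (w b, e b + κ)) := by
    intro b
    rw [Finset.sum_range_succ, Finset.sum_range_one, map_mul, actTranspose_C, actTranspose_X]
    simp only [y, if_true, one_ne_zero, if_false, map_one, map_neg, Nat.factorial_succ, add_zero,
      Nat.cast_mul, map_mul, Nat.cast_add, Nat.cast_one]
    ring
  have h3 : ∀ κ : Fin d → ℕ, (∏ i, MvPolynomial.X i ^ e i : MvPolynomial (Fin d) ℂ) *
      ∏ i, (MvPolynomial.C (y (κ i)) * MvPolynomial.X i ^ κ i) =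
      (∏ i, y (κ i)) • ∏ i, MvPolynomial.X i ^ (e i + κ i) := by
    intro κ
    rw [Finset.prod_mul_distrib, MvPolynomial.smul_eq_C_mul, map_prod]
    simp only [pow_add, Finset.prod_mul_distrib]
    ring
  simp only [h1, h2, Finset.prod_univ_sum, Finset.mul_sum, map_sum, h3, map_smul, substWord_prod]
  refine Finset.sum_congr rfl fun κ _ => ?_
  rw [Finset.prod_mul_distrib (f := fun b => MvPolynomial.C (y (κ b))),
    MvPolynomial.smul_eq_C_mul, map_prod]

theorem mul_X_pow_eq_zero_of_mem_orderLE {k : ℕ} {P : V N} (hP : P ∈ orderLE N k)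
    (w : Fin d → Fin (N + 1)) (l : Fin d) (g : MvPolynomial (Fin d) ℂ) :
    pairing P (substWord w (g * MvPolynomial.X l ^ (k + 1))) = 0 := by
  suffices hs : pairing P ∘ₗ substWord w ∘ₗ
      LinearMap.mulRight ℂ (MvPolynomial.X l ^ (k + 1)) = 0 from LinearMap.congr_fun hs g
  refine linearMap_ext_prod fun e => ?_
  have hp : (∏ i, MvPolynomial.X i ^ e i : MvPolynomial (Fin d) ℂ) * MvPolynomial.X l ^ (k + 1) =
      ∏ i, MvPolynomial.X i ^ (e i + if i = l then k + 1 else 0) := by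
    simp only [pow_add, Finset.prod_mul_distrib, pow_ite, pow_zero, Finset.prod_ite_eq',
      Finset.mem_univ, if_true]
  rw [LinearMap.comp_apply, LinearMap.comp_apply, LinearMap.mulRight_apply, hp, substWord_prod,
    LinearMap.zero_apply, ← Finset.mul_prod_erase _ _ (Finset.mem_univ l), if_pos rfl,
    mul_comm (MvPolynomial.C _), mul_assoc, pairing_X_mul,
    MvPolynomial.pderiv_eq_zero_of_notMem_vars]
  · rw [← sub_self (0 : V N), pairing_sub, sub_self]
  · intro h
    have := MvPolynomial.mem_supported.mp hP (Finset.mem_coe.mpr h)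
    simp only [Set.mem_ofPred_eq] at this
    omega

/-- The lengths of the columns of the diagram with `d` cells all of whose columns, except possibly
the last one, have length `k + 1`. -/
def colLength (k d c : ℕ) : ℕ := min (k + 1) (d - c * (k + 1))

theorem antitone_colLength (k d : ℕ) : Antitone (colLength k d) := by
  intro a b hab
  have := Nat.mul_le_mul_right (k + 1) hab
  simp only [colLength]
  omega

theorem sum_range_colLength (k d t : ℕ) :
    ∑ c ∈ Finset.range t, colLength k d c = min (t * (k + 1)) d := by
  induction t with
  | zero => simp
  | succ t ih =>
    rw [Finset.sum_range_succ, ih, colLength, Nat.succ_mul]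
    omega

theorem colLength_eq_zero {k d c : ℕ} (h : d ≤ c) : colLength k d c = 0 := by
  have : c ≤ c * (k + 1) := Nat.le_mul_of_pos_right c k.succ_pos
  simp only [colLength]
  omega

theorem polarization_mem_harmonics {k : ℕ} {P : V N} (hP : P ∈ VDiffOrder N d k)
    (w : Fin d → Fin (N + 1)) :
    pairing P ∘ₗ substWord w ∈ harmonics (Fin d) (colLength k d) := by
  intro T _ r hr
  rw [sum_range_colLength] at hr
  -- Below |T|(k+1) the order bound gives the vanishing; below d the invariance under all 1 - zT
  -- does.
  rcases min_lt_iff.mp hr with h | h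
  · refine hsum_mem_of_pow_mem (k := k) (fun i g => ?_) ?_
    · exact mul_X_pow_eq_zero_of_mem_orderLE hP.2 w i g
    · rw [Nat.mul_succ] at h
      omega
  · refine hsum_mem_ann_of_invariant (U := Finset.univ) (Finset.subset_univ _) (fun z g => ?_)
      (by simpa using h)
    rw [LinearMap.comp_apply, substWord_mul_prod, ← pairing_act_oneSub, hP.1 (oneSub z),
      constantCoeff_oneSub, one_pow, one_smul, LinearMap.comp_apply]

/-- The polynomial of order at most `k` with prescribed polarization along the word `w`. -/
def ofPolarization (k : ℕ) (w : Fin d → Fin (N + 1)) :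
    (MvPolynomial (Fin d) ℂ →ₗ[ℂ] ℂ) →ₗ[ℂ] V N where
  toFun F := ∑ e : Fin d → Fin (k + 1),
    MvPolynomial.C (F (∏ b, MvPolynomial.X b ^ (e b : ℕ))) *
      ∏ b, PowerSeries.coeff (e b : ℕ) (genericSeries N (w b))
  map_add' F G := by
    simp only [LinearMap.add_apply, map_add, add_mul, Finset.sum_add_distrib]
  map_smul' c F := by
    simp only [LinearMap.smul_apply, smul_eq_mul, map_mul, RingHom.id_apply,
      MvPolynomial.smul_eq_C_mul, Finset.mul_sum, mul_assoc]

/-- By multilinearity in the rows, the sum over exponents reassembles the generic series truncated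
after T^k; the rest is invisible because all levels are at most k. -/
theorem ofPolarization_tabFunctional {k : ℕ} {β : ℕ → ℕ} {π lev : Fin d → ℕ}
    (h : IsFilling β π lev) (hk : ∀ c, β c ≤ k + 1) (w : Fin d → Fin (N + 1)) (a : Fin d → ℕ) :
    ofPolarization k w (tabFunctional π lev a) =
      (blockMatrix π lev fun i =>
        (PowerSeries.X : PowerSeries (V N)) ^ a i * genericSeries N (w i)).det := by
  have hs := det_blockMatrix_sum π lev (Finset.univ : Finset (Fin (k + 1)))
    (fun i e => PowerSeries.coeff (e : ℕ) (genericSeries N (w i)))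
    fun i e => (PowerSeries.X : PowerSeries (V N)) ^ (a i + e)
  rw [Fintype.piFinset_univ] at hs
  have hl : ofPolarization k w (tabFunctional π lev a) = ∑ e : Fin d → Fin (k + 1),
      (∏ i, PowerSeries.coeff (e i : ℕ) (genericSeries N (w i))) *
        (blockMatrix π lev fun i => (PowerSeries.X : PowerSeries (V N)) ^ (a i + e i)).det := by
    refine Finset.sum_congr rfl fun e _ => ?_
    rw [tabFunctional_prod, RingHom.map_det, RingHom.mapMatrix_apply, map_blockMatrix, mul_comm]
    simp only [map_pow, PowerSeries.map_X]
  rw [hl, ← hs]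
  congr 1
  ext1 i j
  rw [blockMatrix_apply, blockMatrix_apply]
  split_ifs with hij
  · have hlt := (h.lt j).trans_le (hk _)
    rw [map_sum, PowerSeries.coeff_X_pow_mul']
    simp only [PowerSeries.coeff_C_mul, PowerSeries.coeff_X_pow, mul_ite, mul_one, mul_zero]
    split_ifs with hle
    · rw [Finset.sum_eq_single_of_mem (⟨lev j - a i, by omega⟩ : Fin (k + 1)) (Finset.mem_univ _)]
      · rw [if_pos (by simp only; omega)]
      · intro e _ he
        rw [if_neg]
        intro h'
        exact he (Fin.ext (by simp only; omega))
    · refine Finset.sum_eq_zero fun e _ => if_neg ?_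
      omega
  · rfl

/-- In the polarization formula each choice of variables splits into a word w and exponents e; the
e! of `substWord` cancels the 1/e! of `genericSeries`. -/
theorem factorial_mul_eq_sum_ofPolarization {k : ℕ} {P : V N} (hP : P ∈ VDiffOrder N d k) :
    MvPolynomial.C (d ! : ℂ) * P =
      ∑ w : Fin d → Fin (N + 1), ofPolarization k w (pairing P ∘ₗ substWord w) := by
  let f : Fin (N + 1) × Fin (k + 1) → Fin (N + 1) × ℕ := fun p => (p.1, p.2)
  have hf : Function.Injective f := by
    rintro ⟨i, j⟩ ⟨i', j'⟩ h
    simp only [f, Prod.mk.injEq] at h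
    exact Prod.ext h.1 (Fin.ext h.2)
  have hs : P ∈ MvPolynomial.supported ℂ (Set.range f) := by
    refine MvPolynomial.supported_mono ?_ hP.2
    rintro ⟨i, j⟩ hj
    simp only [Set.mem_ofPred_eq] at hj
    exact ⟨(i, ⟨j, by omega⟩), rfl⟩
  rw [factorial_mul_eq_sum_pairing hf (isHomogeneous_of_mem_VDiff hP.1) hs,
    ← (Equiv.arrowProdEquivProdArrow (Fin d) (fun _ => Fin (N + 1))
      (fun _ => Fin (k + 1))).symm.sum_comp, Fintype.sum_prod_type]
  refine Finset.sum_congr rfl fun w _ => Finset.sum_congr rfl fun e _ => ?_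
  change MvPolynomial.C (pairing P (∏ b, MvPolynomial.X (w b, (e b : ℕ)))) *
      ∏ b, MvPolynomial.X (w b, (e b : ℕ)) =
    MvPolynomial.C (pairing P (substWord w (∏ b, MvPolynomial.X b ^ (e b : ℕ)))) *
      ∏ b, PowerSeries.coeff (e b : ℕ) (genericSeries N (w b))
  simp only [substWord_prod, coeff_genericSeries, Finset.prod_mul_distrib, ← map_prod]
  rw [← MvPolynomial.smul_eq_C_mul _ (∏ b, ((e b : ℕ)! : ℂ)), map_smul, smul_eq_mul,
    ← mul_assoc, ← map_mul, mul_right_comm, ← Finset.prod_mul_distrib]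
  congr 2
  refine (one_mul _).symm.trans (congrArg (· * _) (Finset.prod_eq_one fun b _ => ?_).symm)
  exact mul_inv_cancel₀ (by exact_mod_cast (e b : ℕ).factorial_ne_zero)

theorem mem_adjoin_detPolys {k : ℕ} {P : V N} (hP : P ∈ VDiffOrder N d k) :
    P ∈ Algebra.adjoin ℂ (detPolys N k) := by
  have hk : ∀ c, colLength k d c ≤ k + 1 := fun c => min_le_left _ _
  have hmem : MvPolynomial.C (d ! : ℂ) * P ∈ Algebra.adjoin ℂ (detPolys N k) := by
    rw [factorial_mul_eq_sum_ofPolarization hP]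
    refine sum_mem fun w _ => ?_
    have hspan := harmonics_le_span d d (colLength k d) (antitone_colLength k d)
      (fun c hc => colLength_eq_zero hc)
      (by rw [sum_range_colLength]; exact min_eq_right (Nat.le_mul_of_pos_right d k.succ_pos))
      (polarization_mem_harmonics hP w)
    have hle : Submodule.span ℂ (tabFunctionals (Fin d) (colLength k d)) ≤
        (Subalgebra.toSubmodule (Algebra.adjoin ℂ (detPolys N k))).comap (ofPolarization k w) := by
      rw [Submodule.span_le]
      rintro _ ⟨π, lev, a, h, rfl⟩
      change ofPolarization k w (tabFunctional π lev a) ∈ Algebra.adjoin ℂ (detPolys N k)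
      rw [ofPolarization_tabFunctional h hk]
      exact det_blockMatrix_mem_adjoin h hk w a
    exact hle hspan
  have hne : (d ! : ℂ) ≠ 0 := by exact_mod_cast d.factorial_ne_zero
  have := Subalgebra.smul_mem _ hmem (d ! : ℂ)⁻¹
  rwa [MvPolynomial.smul_eq_C_mul, ← mul_assoc, ← map_mul, inv_mul_cancel₀ hne, map_one,
    one_mul] at this

end Polarization

/-! ### Reduction to homogeneous components and passage to arbitrary bases. -/

section Main

variable {N : ℕ}

theorem orderLE_mono {k l : ℤ} (h : k ≤ l) : orderLE N k ≤ orderLE N l :=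
  MvPolynomial.supported_mono fun p (hp : (p.2 : ℤ) ≤ k) => hp.trans h

theorem mem_of_mem_orderLE_of_neg {k : ℤ} (hk : k < 0) {P : V N} (hP : P ∈ orderLE N k)
    (A : Subalgebra ℂ (V N)) : P ∈ A := by
  have hvars : P.vars = ∅ := by
    refine Finset.eq_empty_of_forall_notMem fun p hp => ?_
    have := MvPolynomial.mem_supported.mp hP (Finset.mem_coe.mpr hp)
    simp only [Set.mem_ofPred_eq] at this
    omega
  rw [MvPolynomial.vars_eq_empty_iff_eq_C] at hvars
  rw [hvars]
  exact Subalgebra.algebraMap_mem _ _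

theorem homogeneousComponent_mem_VDiff {P : V N} (hP : P ∈ diffAlgebra N) (d : ℕ) :
    MvPolynomial.homogeneousComponent d P ∈ VDiff N d := by
  change P ∈ ⨆ d : ℕ, VDiff N d at hP
  induction hP using Submodule.iSup_induction' with
  | mem e P hP =>
    rw [MvPolynomial.homogeneousComponent_of_mem (isHomogeneous_of_mem_VDiff hP)]
    split_ifs with h
    · rw [h]
      exact hP
    · exact zero_mem _
  | zero => rw [map_zero]; exact zero_mem _
  | add P Q _ _ hP hQ => rw [map_add]; exact add_mem hP hQ

theorem homogeneousComponent_mem_orderLE {P : V N} {k : ℤ} (hP : P ∈ orderLE N k) (d : ℕ) :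
    MvPolynomial.homogeneousComponent d P ∈ orderLE N k := by
  classical
  refine MvPolynomial.mem_supported.mpr fun i hi => ?_
  obtain ⟨m, hm, him⟩ := (MvPolynomial.mem_vars_iff_mem_support i).mp (Finset.mem_coe.mp hi)
  rw [MvPolynomial.mem_support_iff, MvPolynomial.coeff_homogeneousComponent] at hm
  refine MvPolynomial.mem_supported.mp hP (Finset.mem_coe.mpr
    ((MvPolynomial.mem_vars_iff_mem_support i).mpr ⟨m, ?_, him⟩))
  rw [MvPolynomial.mem_support_iff]
  split_ifs at hm with h
  · exact hm
  · exact absurd rfl hm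

theorem VDiffOrder_le_diffAlgebraOrder {d : ℕ} {k : ℤ} {P : V N} (hP : P ∈ VDiffOrder N d k) :
    P ∈ diffAlgebraOrder N k :=
  ⟨Submodule.mem_iSup_of_mem d hP.1, hP.2⟩

theorem detPoly_mem_VDiffOrder (N b : ℕ) (w : Fin b → Fin (N + 1)) (a : Fin b → ℕ) :
    detPoly N b w a ∈ VDiffOrder N b ((b : ℤ) - 1) :=
  ⟨detPoly_mem_VDiff N b w a, detPoly_mem_orderLE N b w a⟩

/-- The differentially homogeneous polynomials of order at most `k` are generated by the
determinants of size at most `k + 1`. -/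
theorem diffAlgebraOrder_eq_adjoin_detPolys (N k : ℕ) :
    diffAlgebraOrder N k = Algebra.adjoin ℂ (detPolys N k) := by
  refine le_antisymm ?_ (Algebra.adjoin_le ?_)
  · intro P hP
    rw [← MvPolynomial.sum_homogeneousComponent P]
    exact sum_mem fun d _ => mem_adjoin_detPolys
      ⟨homogeneousComponent_mem_VDiff hP.1 d, homogeneousComponent_mem_orderLE hP.2 d⟩
  · rintro _ ⟨b, hb, w, a, rfl⟩
    have h := VDiffOrder_le_diffAlgebraOrder (detPoly_mem_VDiffOrder N b w a)
    exact ⟨h.1, orderLE_mono (by omega) h.2⟩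

theorem InducesBasis.exists_span {E : Type*} [AddCommGroup E] [Module ℂ E] {W W' : Submodule ℂ E}
    {ι : Type*} {b : ι → W} (h : InducesBasis W W' b) {x : E} (hx : x ∈ W) :
    ∃ y ∈ Submodule.span ℂ (Set.range fun j => (b j : E)), x - y ∈ W' := by
  have hmem : (W'.submoduleOf W).mkQ ⟨x, hx⟩ ∈
      Submodule.span ℂ (Set.range fun j => (W'.submoduleOf W).mkQ (b j)) := by
    rw [h.2]
    exact Submodule.mem_top
  rw [Set.range_comp' (W'.submoduleOf W).mkQ b, Submodule.span_image] at hmem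
  obtain ⟨y, hy, hxy⟩ := hmem
  refine ⟨y, ?_, ?_⟩
  · have := Submodule.mem_map_of_mem (f := W.subtype) hy
    rwa [← Submodule.span_image, ← Set.range_comp] at this
  · rw [Submodule.mkQ_apply, Submodule.mkQ_apply, eq_comm, Submodule.Quotient.eq] at hxy
    exact hxy

end Main

end DiffHom

end

theorem mainTheorem2 (N k : ℕ) :
    (DiffHom.diffAlgebraOrder N k).FG ∧
    ∀ (ι : Set.Icc 1 (k + 1) → Type*)
      (B : (i : Set.Icc 1 (k + 1)) → ι i → DiffHom.VDiffOrder N (i : ℕ) (((i : ℕ) : ℤ) - 1)),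
      (∀ i : Set.Icc 1 (k + 1),
        DiffHom.InducesBasis
          (DiffHom.VDiffOrder N (i : ℕ) (((i : ℕ) : ℤ) - 1))
          (DiffHom.VDiffOrder N (i : ℕ) (((i : ℕ) : ℤ) - 2))
          (B i)) →
      DiffHom.diffAlgebraOrder N k =
        Algebra.adjoin ℂ
          (⋃ i : Set.Icc 1 (k + 1), Set.range fun j : ι i => (B i j : DiffHom.V N)) := by
  refine ⟨?_, fun ι B hB => ?_⟩
  · rw [DiffHom.diffAlgebraOrder_eq_adjoin_detPolys]
    exact Subalgebra.fg_def.mpr ⟨_, DiffHom.detPolys_finite N k, rfl⟩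
  set A := Algebra.adjoin ℂ
    (⋃ i : Set.Icc 1 (k + 1), Set.range fun j : ι i => (B i j : DiffHom.V N)) with hA
  have key : ∀ i, i ≤ k + 1 → ∀ P ∈ DiffHom.VDiffOrder N i ((i : ℤ) - 1), P ∈ A := by
    intro i
    induction i using Nat.strong_induction_on with
    | _ i ih =>
      intro hi P hP
      -- For i ≥ 2, order at most i - 2 means a polynomial in determinants of size at most i - 1,
      -- all covered by the induction hypothesis; for i < 2 the order is negative and only constants
      -- occur.
      have hlow : ∀ Q ∈ DiffHom.VDiffOrder N i ((i : ℤ) - 2), Q ∈ A := by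
        intro Q hQ
        rcases Nat.lt_or_ge i 2 with h2 | h2
        · exact DiffHom.mem_of_mem_orderLE_of_neg (by omega) hQ.2 A
        · obtain ⟨l, rfl⟩ : ∃ l, i = l + 2 := ⟨i - 2, by omega⟩
          have hl : (((l + 2 : ℕ) : ℤ) - 2) = (l : ℤ) := by push_cast; ring
          rw [hl] at hQ
          have hQ' := DiffHom.mem_adjoin_detPolys hQ
          refine Algebra.adjoin_le ?_ hQ'
          rintro _ ⟨b, hb, w, a, rfl⟩
          exact ih b (by omega) (by omega) _ (DiffHom.detPoly_mem_VDiffOrder N b w a)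
      -- Size 0 has no family B_i, but the empty determinant belongs to `detPolys`; order at most -1
      -- makes it a constant.
      rcases Nat.eq_zero_or_pos i with rfl | hpos
      · exact DiffHom.mem_of_mem_orderLE_of_neg (by simp) hP.2 A
      · obtain ⟨y, hy, hxy⟩ := (hB ⟨i, hpos, hi⟩).exists_span hP
        have hyA : y ∈ A := by
          refine (Submodule.span_le (p := Subalgebra.toSubmodule A)).mpr ?_ hy
          rintro _ ⟨j, rfl⟩
          exact Algebra.subset_adjoin (Set.mem_iUnion.mpr ⟨⟨i, hpos, hi⟩, j, rfl⟩)
        have := add_mem (hlow _ hxy) hyA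
        rwa [sub_add_cancel] at this
  refine le_antisymm ?_ (Algebra.adjoin_le ?_)
  · rw [DiffHom.diffAlgebraOrder_eq_adjoin_detPolys]
    refine Algebra.adjoin_le ?_
    rintro _ ⟨b, hb, w, a, rfl⟩
    exact key b hb _ (DiffHom.detPoly_mem_VDiffOrder N b w a)
  · refine Set.iUnion_subset fun i => ?_
    rintro _ ⟨j, rfl⟩
    have h := DiffHom.VDiffOrder_le_diffAlgebraOrder (B i j).2
    refine ⟨h.1, DiffHom.orderLE_mono ?_ h.2⟩
    have := i.2.2
    omega
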